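/- **Setting.** Let $H$ be a real separable Hilbert space, $\mathcal F\subseteq H$ an open set, $\Pi(\mathcal F)$ the set of Borel probability measures on $\mathcal F$, and $\mathcal Z$ a measurable space with a probability measure $\mathbf P$. Let $\ell:\mathcal F\times\mathcal Z\to\mathbb R$ be jointly measurable, with $\ell(f,\cdot)$ $\mathbf P$-integrable for all $f$ and $\ell(\cdot,z)$ Fréchet differentiable for all $z$, and suppose that the risk $r(f)=\int\ell(f,z)\,\mathbf P(dz)$ is Fréchet differentiable on $\mathcal F$. Put $\Delta(f,z)=r(f)-\ell(f,z)$, with gradient $\nabla\Delta$ in $f$. For $S=(z_1,\dots,z_n)$, $n\ge 1$, let $\mathbf P_S=\frac1n\sum_i\delta_{z_i}$ and $\hat r_S(f)=\frac1n\sum_i\ell(f,z_i)$. For a measure $\mathbf Q$ and a function $g$, $\mathbf Q g$ denotes $\int g\,d\mathbf Q$. Let $\Sigma$ be a measurable map from $\mathcal F$ to the bounded symmetric nonnegative operators on $H$, and put $|v|_{\mathcal T_f}=\sqrt{\langle v,\Sigma^{-1}(f)v\rangle}$ for $v\in\Sigma(f)H$ and $|v|_{\mathcal T_f}=\infty$ otherwise.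 Assume that for some $L_\Delta>0$, $$\limsup_{\rho\downarrow0}\ \sup_{g\in\mathcal F,\ |g-f|_{\mathcal T_f}\le\rho}\frac{|\Delta(g,z)-\Delta(f,z)|}{\rho}\le L_\Delta\qquad\text{for all } f\in\mathcal F,\ z\in\mathcal Z .$$ **Posterior flows.** A posterior flow started from $\mathbf Q\in\Pi(\mathcal F)$ consists of a probability space $(\Omega_0,P_0)$, a jointly measurable random vector field $\xi_t(f,\omega)$, $t\ge0$, and random variables $f_t$, $t\ge 0$, on the product of $(\mathcal F,\mathbf Q)$ and $(\Omega_0,P_0)$, such that almost surely $f_0$ is the first coordinate (so $f_0\sim\mathbf Q$ and $\omega_0\sim P_0$ are independent), $f_t\in\mathcal F$ for all $t$, and $t\mapsto f_t$ is continuous and solves $\frac{d}{dt}f_t=\xi_t(f_t,\omega_0)$ on $[0,\infty)$, except possibly at countably many times; and such that $\int_0^\tau\mathbb E\,|\xi_t(f_t,\omega_0)|_{\mathcal T_{f_t}}dt<\infty$ for all $\tau\ge 0$. Let $\mathbf Q_t^\xi$ be the law of $f_t$, $\mu_t(f)=\mathbb E[\xi_t(f_t,\omega_0)\mid f_t=f]$,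 and $$W_t(\xi)=\sqrt{\int|\mu_t(f)|_{\mathcal T_f}^2\,\mathbf Q_t^\xi(df)},\qquad V_t(\xi;S)=\sqrt{\iint\langle\mu_t(f),\nabla\Delta(f,z)\rangle^2\,\tfrac{\mathbf P+\mathbf P_S}{2}(dz)\,\mathbf Q_t^\xi(df)} .$$ **OT distance.** For $\mathbf U\in\Pi(\mathcal F)$ and $\delta\in(0,1)$ let $H_\delta(\mathbf Q,\mathbf U)=D_{\mathrm{KL}}(\mathbf Q,\mathbf U)+\ln\frac1\delta$, $c(n)=\ln(e+\ln^2(2n^2))$, $$\iota_t(\xi;S,\mathbf U,\delta)=2V_t(\xi;S)\sqrt{\frac{H_\delta(\mathbf Q_t^\xi,\mathbf U)+c(n)}{n}}+\frac{2L_\Delta W_t(\xi)}{\sqrt n}\in[0,\infty]$$ (with $0\cdot\infty=0$), and $$d_{S,\mathbf U,\delta}(\mathbf Q,\mathbf Q')=\inf_{\xi:\ \mathbf Q_0^\xi=\mathbf Q,\ \mathbf Q_1^\xi=\mathbf Q'}\int_0^1\iota_t(\xi;S,\mathbf U,\delta)\,dt\in[0,\infty].$$ **Corollary 1 (Transportation-based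 risk bound).** Fix a prior $\mathbf U\in\Pi(\mathcal F)$ and $\delta\in(0,1)$. Then, with probability at least $1-\delta$ on the draw of $S\sim\mathbf P^n$, simultaneously for all posteriors $\mathbf Q_0,\mathbf Q\in\Pi(\mathcal F)$ such that $r$ and $\hat r_S$ are $\mathbf Q$-integrable and $\mathbf P_S\Delta$ is $\mathbf Q_0$-integrable, $$\mathbf Q r\ \le\ \mathbf Q\hat r_S+d_{S,\mathbf U,\delta}(\mathbf Q,\mathbf Q_0)+\mathbf Q_0\mathbf P_S\Delta .$$ -/

import Mathlib

open MeasureTheory ProbabilityTheory Set Filter Topology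
open scoped ENNReal NNReal

universe u v w

namespace PACBayes

noncomputable section

section Loss

variable {H : Type u} {Z : Type v} [MeasurableSpace Z]

/-- The risk `r(f) = P ℓ(f)`. -/
def risk (P : Measure Z) (ℓ : H → Z → ℝ) (f : H) : ℝ := ∫ z, ℓ f z ∂P

/-- The deviation function of a single observation, `Δ(f, z) = r(f) - ℓ(f, z)`. -/
def deviation (P : Measure Z) (ℓ : H → Z → ℝ) (f : H) (z : Z) : ℝ := risk P ℓ f - ℓ f z

/-- The empirical risk `r̂_S(f) = P_S ℓ(f) = (1/n) ∑ i, ℓ(f, z_i)`. -/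
def empRisk {n : ℕ} (ℓ : H → Z → ℝ) (S : Fin n → Z) (f : H) : ℝ :=
  (∑ i, ℓ f (S i)) / n

/-- The sample-averaged deviation `P_S Δ(f) = (1/n) ∑ i, Δ(f, z_i)`. -/
def empDeviation {n : ℕ} (P : Measure Z) (ℓ : H → Z → ℝ) (S : Fin n → Z) (f : H) : ℝ :=
  (∑ i, deviation P ℓ f (S i)) / n

/-- The empirical distribution `P_S = (1/n) ∑ i, δ_{z_i}`. -/
def empMeasure {n : ℕ} (S : Fin n → Z) : Measure Z :=
  (n : ℝ≥0∞)⁻¹ • ∑ i, Measure.dirac (S i)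

end Loss

section Metric

variable {H : Type u} [NormedAddCommGroup H] [InnerProductSpace ℝ H]

/-- The local norm `|v| = √⟪v, A⁻¹ v⟫` for `v` in the range of the symmetric nonnegative operator
`A`, and `|v| = ∞` otherwise. For `v` in the range, `⟪v, w⟫` is the same for all `w` with
`A w = v`; for `v` outside the range the infimum is over the empty set, hence `∞`. -/
def localNorm (A : H →L[ℝ] H) (v : H) : ℝ≥0∞ :=
  ⨅ (x : H) (_ : A x = v), ENNReal.ofReal (√(inner ℝ v x))

/-- The deviation function is `L`-Lipschitz on `F` with respect to the inverse metric `Sig`: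
`lim_{ρ → 0} sup_{|g - f|_{T_f} ≤ ρ} |Δ(g, z) - Δ(f, z)| / ρ ≤ L` for all `f ∈ F` and all `z`. -/
def LipschitzDeviation {Z : Type v} [MeasurableSpace Z] (P : Measure Z) (ℓ : H → Z → ℝ)
    (F : Set H) (Sig : H → H →L[ℝ] H) (L : ℝ≥0) : Prop :=
  ∀ f ∈ F, ∀ z : Z,
    limsup (fun ρ : ℝ =>
      (⨆ (g : H) (_ : g ∈ F) (_ : localNorm (Sig f) (g - f) ≤ ENNReal.ofReal ρ),
        ‖deviation P ℓ g z - deviation P ℓ f z‖ₑ) / ENNReal.ofReal ρ) (𝓝[>] 0) ≤ (L : ℝ≥0∞)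

end Metric

section Flow

variable {H : Type u} [NormedAddCommGroup H] [InnerProductSpace ℝ H] [MeasurableSpace H]

/-- A posterior flow on `F` started from `Q₀`: a random time-indexed vector field
`ξ_t(f, ω)`, with `ω` drawn from a probability space `(Ω, P₀)` independently of the initial point
`f_0 ∼ Q₀`, together with a solution `f_t` of `df_t = ξ_t(f_t, ω) dt` on the time line
`[0, ∞)`. -/
structure PosteriorFlow (F : Set H) (Sig : H → H →L[ℝ] H) (Q₀ : Measure H) where
  /-- the source of randomness of the transportation -/
  Ω : Type w
  [mΩ : MeasurableSpace Ω]
  /-- its law -/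
  P₀ : Measure Ω
  [isProb : IsProbabilityMeasure P₀]
  /-- the random vector field -/
  ξ : ℝ → H → Ω → H
  measurable_ξ : Measurable (fun p : ℝ × H × Ω => ξ p.1 p.2.1 p.2.2)
  /-- the solution, as a function of the initial point and of `ω` -/
  sol : ℝ → H × Ω → H
  aemeasurable_sol : ∀ t, 0 ≤ t → AEMeasurable (sol t) (Q₀.prod P₀)
  sol_zero : ∀ᵐ p ∂(Q₀.prod P₀), sol 0 p = p.1
  sol_mem : ∀ᵐ p ∂(Q₀.prod P₀), ∀ t, 0 ≤ t → sol t p ∈ F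
  /-- Almost every path solves the differential equation (countably many kinks are allowed, so
  that flows can be stopped and concatenated). -/
  sol_ode : ∀ᵐ p ∂(Q₀.prod P₀), ContinuousOn (fun t => sol t p) (Ici 0) ∧
    ∃ C : Set ℝ, C.Countable ∧ ∀ t, 0 ≤ t → t ∉ C →
      HasDerivWithinAt (fun s => sol s p) (ξ t (sol t p) p.2) (Ici 0) t
  /-- The expected length of the paths, in the local norms, is finite on bounded time intervals. -/
  length_lt_top : ∀ τ : ℝ, 0 ≤ τ →
    ∫⁻ t in Icc 0 τ, ∫⁻ p, localNorm (Sig (sol t p)) (ξ t (sol t p) p.2) ∂(Q₀.prod P₀) < ∞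

attribute [instance] PosteriorFlow.mΩ PosteriorFlow.isProb

namespace PosteriorFlow

variable {F : Set H} {Sig : H → H →L[ℝ] H} {Q₀ : Measure H}

/-- The joint law of `(f_0, ω)`. -/
def joint (X : PosteriorFlow.{u, w} F Sig Q₀) : Measure (H × X.Ω) := Q₀.prod X.P₀

/-- The snapshot distribution at time `t`, the law of `f_t`. -/
def law (X : PosteriorFlow.{u, w} F Sig Q₀) (t : ℝ) : Measure H := X.joint.map (X.sol t)

variable [BorelSpace H] [CompleteSpace H] [SecondCountableTopology H] [IsProbabilityMeasure Q₀]

instance (X : PosteriorFlow.{u, w} F Sig Q₀) : IsProbabilityMeasure X.joint := by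
  unfold joint; infer_instance

/-- The mean posterior flow `μ_t(f) = E[ξ_t(f_t, ω) | f_t = f]`, the mean of the regular
conditional distribution of `ξ_t(f_t, ω)` given `f_t = f`. -/
def mean (X : PosteriorFlow.{u, w} F Sig Q₀) (t : ℝ) (f : H) : H :=
  ∫ x, x ∂(condDistrib (fun p : H × X.Ω => X.ξ t (X.sol t p) p.2) (X.sol t) X.joint f)

/-- The Wasserstein velocity `W_t(ξ) = √(E_{f ∼ Q_t} |μ_t(f)|²_{T_f})`. -/
def wassersteinVelocity (X : PosteriorFlow.{u, w} F Sig Q₀) (t : ℝ) : ℝ≥0∞ :=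
  (∫⁻ f, localNorm (Sig f) (X.mean t f) ^ 2 ∂(X.law t)) ^ (1 / 2 : ℝ)

/-- The deviation-based velocity `V_t(ξ; S) = √(Q_t ((P + P_S) / 2) ⟪μ_t, ∇Δ⟫²)`. -/
def deviationVelocity {Z : Type v} [MeasurableSpace Z] {n : ℕ} (P : Measure Z) (ℓ : H → Z → ℝ)
    (S : Fin n → Z) (X : PosteriorFlow.{u, w} F Sig Q₀) (t : ℝ) : ℝ≥0∞ :=
  (∫⁻ f, ∫⁻ z, ENNReal.ofReal
      ((inner ℝ (X.mean t f) (gradient (fun g => deviation P ℓ g z) f)) ^ 2)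
    ∂((2 : ℝ≥0∞)⁻¹ • (P + empMeasure S)) ∂(X.law t)) ^ (1 / 2 : ℝ)

end PosteriorFlow

/-- The complexity `H_δ(Q, U) = D_KL(Q, U) + ln (1/δ)`. -/
def complexity (δ : ℝ) (Q U : Measure H) : ℝ≥0∞ :=
  InformationTheory.klDiv Q U + ENNReal.ofReal (Real.log (1 / δ))

/-- `c(n) = ln (e + ln² (2 n²))`. -/
def cConst (n : ℕ) : ℝ := Real.log (Real.exp 1 + (Real.log (2 * (n : ℝ) ^ 2)) ^ 2)

variable [BorelSpace H] [CompleteSpace H] [SecondCountableTopology H]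

/-- The increment bound
`ι_t(ξ; S, U, δ) = 2 V_t(ξ; S) √((H_δ(Q_t, U) + c(n)) / n) + 2 L W_t(ξ) / √n`. -/
def incrementBound {Z : Type v} [MeasurableSpace Z] {n : ℕ} (P : Measure Z) (ℓ : H → Z → ℝ)
    (L : ℝ≥0) (S : Fin n → Z) (U : Measure H) (δ : ℝ)
    {F : Set H} {Sig : H → H →L[ℝ] H} {Q₀ : Measure H} [IsProbabilityMeasure Q₀]
    (X : PosteriorFlow.{u, w} F Sig Q₀) (t : ℝ) : ℝ≥0∞ :=
  2 * X.deviationVelocity P ℓ S t *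
      ((complexity δ (X.law t) U + ENNReal.ofReal (cConst n)) / (n : ℝ≥0∞)) ^ (1 / 2 : ℝ)
    + 2 * (L : ℝ≥0∞) * X.wassersteinVelocity t / (n : ℝ≥0∞) ^ (1 / 2 : ℝ)

/-- The optimal transportation distance `d_{S,U,δ}(Q, Q')`: the infimum of
`∫_0^1 ι_t(ξ; S, U, δ) dt` over all posterior flows with snapshot `Q` at time `0` and `Q'` at
time `1` (`∞` if there is none). -/
def otDistance {Z : Type v} [MeasurableSpace Z] {n : ℕ} (P : Measure Z) (ℓ : H → Z → ℝ)
    (F : Set H) (Sig : H → H →L[ℝ] H) (L : ℝ≥0) (S : Fin n → Z) (U : Measure H) (δ : ℝ)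
    (Q Q' : Measure H) [IsProbabilityMeasure Q] : ℝ≥0∞ :=
  ⨅ (X : PosteriorFlow.{u, w} F Sig Q) (_ : X.law 1 = Q'),
    ∫⁻ t in Icc (0 : ℝ) 1, incrementBound P ℓ L S U δ X t

end Flow

end

end PACBayes

/-!
# A transportation-based risk bound

Along a posterior flow `f_t` with velocity `ξ_t`, the fundamental theorem of calculus gives, for
each observation `z`, `E Δ(f_1, z) - E Δ(f_0, z) = ∫_0^1 E ⟪ξ_t(f_t), ∇Δ(f_t, z)⟫ dt`, and
conditioning on `f_t` replaces `ξ_t` by the mean flow `μ_t`. It therefore suffices to find one event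
of probability at least `1 - δ` on which, simultaneously for all laws `Q` and all vector fields `μ`,
`|Q ⟪μ, P_S ∇Δ⟫|` is at most the increment bound with `Q_t = Q` and `μ_t = μ`
(`PACBayes.abs_integral_le_increment`); integrating over `t` yields
`PACBayes.ofReal_integral_empDeviation_sub_le`, and the infimum over flows the theorem.

**Uniformity over vector fields.** For a fixed direction `m`, the variables
`X = λ ⟪m, ∇Δ(f, z)⟫` satisfy the self-normalized moment bound
`E exp (∑ (X - X² / 2 - P X - P X² / 2)) ≤ 1` (`PACBayes.lintegral_exp_empExponent_le_one`, from
`exp (x - x² / 2) ≤ 1 + x + x² / 2`). Mixing over `m` with a centered Gaussian of covariance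
`s Sig(f)` keeps the expectation at most one, and the change of measure that shifts the Gaussian to
any `m = Sig(f) x` bounds the mixture below by the exponential at `m`, at the price
`λ² |m|² / (2 s)` of the shift and `n s L²` of the spread (`PACBayes.exp_le_limitMixture`). The price
of the shift is where the Wasserstein velocity comes from. In infinite dimensions there is no such
Gaussian vector in `H` unless `Sig(f)` is trace class, so the mixture is built from the Gaussian
combinations of the first `k` vectors of a Cholesky decomposition of `Sig(f)` along a dense
sequence, and passes to the limit inferior as `k → ∞`; the Cholesky vectors depend measurably on
`f`, and the Lipschitz condition bounds `⟪Sig(f) ∇Δ, ∇Δ⟫` by `L²`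
(`PACBayes.inner_extSig_extGrad_le`), so that the spread is bounded uniformly in `k`.

**Uniformity over laws.** The Donsker–Varadhan inequality (`PACBayes.integral_le_klDiv_add_log`)
with the prior `U` allows `m` to depend on `f` and `f` to be drawn from any `Q`. The outcome is an
inequality quadratic in `λ`, whose discriminant gives the bound for a fixed `s`. The best `s`
depends on `μ` and `Q`; the dyadic values `s = 2 ^ k / (n L²)` with `2 ^ k < n` suffice
(`PACBayes.exists_dyadic_balance`), and their number is at most `exp c(n)`. When the complexity term
exceeds `1 / 2`, the Cauchy–Schwarz inequality over the sample already gives the bound.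

**Centering.** The bound needs `P ⟪μ_t, ∇Δ⟫ = 0`. Differentiation under `P` is not available, but
`P Δ(f) = 0` for all `f ∈ F`, so the integral of `P ⟪ξ_t, ∇Δ⟫` over every initial time interval
vanishes by Fubini along almost every path; hence `P ⟪ξ_t, ∇Δ⟫ = 0` for almost every `t`
(`PACBayes.ae_ae_integral_inner_extGrad_eq_zero`), and this passes to the conditional mean.
-/

namespace PACBayes

/-! ### Gaussian changes of measure -/

/-- The standard Gaussian measure on `Fin k → ℝ`. -/
noncomputable def gaussianVec (k : ℕ) : Measure (Fin k → ℝ) :=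
  Measure.pi fun _ => gaussianReal 0 1

instance (k : ℕ) : IsProbabilityMeasure (gaussianVec k) := by
  unfold gaussianVec; infer_instance

/-- Shift of a one-dimensional Gaussian expressed as an exponential change of measure. -/
lemma gaussianReal_eq_withDensity (m : ℝ) :
    gaussianReal m 1 = (gaussianReal 0 1).withDensity
      (fun w => ENNReal.ofReal (Real.exp (w * m - m ^ 2 / 2))) := by
  rw [gaussianReal_of_var_ne_zero _ one_ne_zero, gaussianReal_of_var_ne_zero _ one_ne_zero,
    ← withDensity_mul _ (measurable_gaussianPDF _ _) (by fun_prop)]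
  congr 1
  ext w
  simp only [gaussianPDF, Pi.mul_apply, gaussianPDFReal]
  rw [← ENNReal.ofReal_mul (by positivity), mul_assoc _ (Real.exp _) (Real.exp _), ← Real.exp_add]
  congr 3
  push_cast
  ring

lemma lintegral_pi_prod {ι : Type*} [Fintype ι] {E : ι → Type*} [∀ i, MeasurableSpace (E i)]
    (μ : ∀ i, Measure (E i)) [∀ i, IsProbabilityMeasure (μ i)] (f : ∀ i, E i → ℝ≥0∞)
    (hf : ∀ i, Measurable (f i)) :
    ∫⁻ x, ∏ i, f i (x i) ∂(Measure.pi μ) = ∏ i, ∫⁻ x, f i x ∂(μ i) := by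
  rw [lintegral_prod_eq_prod_lintegral_of_indepFun (μ := Measure.pi μ) Finset.univ
    (fun i x => f i (x i)) (iIndepFun_pi fun i => (hf i).aemeasurable)
    (fun i => (hf i).comp (measurable_pi_apply i))]
  refine Finset.prod_congr rfl fun i _ => ?_
  rw [← lintegral_map (hf i) (measurable_pi_apply i), (measurePreserving_eval μ i).map_eq]

/-- Cameron–Martin formula for the standard Gaussian on `Fin k → ℝ`. -/
lemma pi_gaussianReal_eq_withDensity {k : ℕ} (m : Fin k → ℝ) :
    Measure.pi (fun j => gaussianReal (m j) 1) = (gaussianVec k).withDensity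
      (fun w => ENNReal.ofReal (Real.exp (∑ j, (w j * m j - m j ^ 2 / 2)))) := by
  refine Measure.pi_eq fun s hs => ?_
  rw [withDensity_apply _ (MeasurableSet.univ_pi hs), ← lintegral_indicator (MeasurableSet.univ_pi hs)]
  have h : ∀ w : Fin k → ℝ, (Set.univ.pi s).indicator
      (fun w => ENNReal.ofReal (Real.exp (∑ j, (w j * m j - m j ^ 2 / 2)))) w
      = ∏ j, (s j).indicator (fun x => ENNReal.ofReal (Real.exp (x * m j - m j ^ 2 / 2))) (w j) := by
    intro w
    by_cases hw : w ∈ Set.univ.pi s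
    · rw [indicator_of_mem hw, Real.exp_sum, ENNReal.ofReal_prod_of_nonneg fun _ _ => by positivity]
      exact Finset.prod_congr rfl fun j _ => by rw [indicator_of_mem (hw j (mem_univ j))]
    · rw [indicator_of_notMem hw]
      simp only [Set.mem_pi, mem_univ, true_imp_iff, not_forall] at hw
      obtain ⟨j, hj⟩ := hw
      exact (Finset.prod_eq_zero (Finset.mem_univ j) (indicator_of_notMem hj _)).symm
  simp_rw [h]
  rw [gaussianVec, lintegral_pi_prod _ _ fun j => Measurable.indicator (by fun_prop) (hs j)]
  refine Finset.prod_congr rfl fun j _ => ?_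
  rw [lintegral_indicator (hs j), gaussianReal_eq_withDensity (m j), withDensity_apply _ (hs j)]

lemma memLp_pi_gaussianReal_sum {k : ℕ} (m y : Fin k → ℝ) :
    MemLp (fun w => ∑ j, w j * y j) 2 (Measure.pi fun j => gaussianReal (m j) 1) := by
  refine memLp_finsetSum _ fun j _ => ?_
  have : MemLp (fun x : ℝ => x * y j) 2 (gaussianReal (m j) 1) :=
    (memLp_id_gaussianReal' 2 (by simp)).mul_const _
  exact this.comp_measurePreserving (measurePreserving_eval (fun j => gaussianReal (m j) 1) j)

lemma integral_pi_gaussianReal_sum {k : ℕ} (m y : Fin k → ℝ) :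
    ∫ w, ∑ j, w j * y j ∂(Measure.pi fun j => gaussianReal (m j) 1) = ∑ j, m j * y j := by
  have h : ∀ j, Integrable (fun w : Fin k → ℝ => w j * y j)
      (Measure.pi fun j => gaussianReal (m j) 1) := fun j => by
    have : MemLp (fun x : ℝ => x * y j) 2 (gaussianReal (m j) 1) :=
      (memLp_id_gaussianReal' 2 (by simp)).mul_const _
    exact (this.comp_measurePreserving
      (measurePreserving_eval (fun j => gaussianReal (m j) 1) j)).integrable (by simp)
  rw [integral_finsetSum _ fun j _ => h j]
  refine Finset.sum_congr rfl fun j _ => ?_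
  rw [integral_comp_eval (μ := fun j => gaussianReal (m j) 1) (i := j) (f := fun x => x * y j)
    (by fun_prop), integral_mul_const, integral_id_gaussianReal]

lemma integral_pi_gaussianReal_sum_sq {k : ℕ} (m y : Fin k → ℝ) :
    ∫ w, (∑ j, w j * y j) ^ 2 ∂(Measure.pi fun j => gaussianReal (m j) 1)
      = (∑ j, m j * y j) ^ 2 + ∑ j, y j ^ 2 := by
  have hv := variance_eq_sub (memLp_pi_gaussianReal_sum m y)
  have hs := variance_sum_pi (μ := fun j => gaussianReal (m j) 1) (X := fun j x => x * y j)
    (fun j => (memLp_id_gaussianReal' 2 (by simp)).mul_const _)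
  have he : (∑ i, fun ω : Fin k → ℝ => ω i * y i) = fun w => ∑ j, w j * y j := by
    ext w; simp
  rw [he, hv, integral_pi_gaussianReal_sum] at hs
  have h1 : ∀ j, Var[fun x => x * y j; gaussianReal (m j) 1] = y j ^ 2 := fun j => by
    simp_rw [mul_comm _ (y j)]
    rw [variance_const_mul, variance_fun_id_gaussianReal]; simp
  simp_rw [h1] at hs
  simp only [Pi.pow_apply] at hs
  linarith

lemma integral_exp_ge_exp_integral {α : Type*} [MeasurableSpace α] (μ : Measure α)
    [IsProbabilityMeasure μ] {f : α → ℝ} (hf : Integrable f μ) :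
    ENNReal.ofReal (Real.exp (∫ x, f x ∂μ)) ≤ ∫⁻ x, ENNReal.ofReal (Real.exp (f x)) ∂μ := by
  set a := ∫ x, f x ∂μ with ha
  have h1 : ∀ x, Real.exp a * (1 + (f x - a)) ≤ Real.exp (f x) := fun x => by
    have := Real.add_one_le_exp (f x - a)
    calc Real.exp a * (1 + (f x - a)) ≤ Real.exp a * Real.exp (f x - a) := by gcongr; linarith
      _ = _ := by rw [← Real.exp_add]; ring_nf
  have hi : Integrable (fun x => Real.exp a * (1 + (f x - a))) μ :=
    (((integrable_const 1).add (hf.sub (integrable_const a)))).const_mul _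
  calc ENNReal.ofReal (Real.exp a)
      = ENNReal.ofReal (∫ x, Real.exp a * (1 + (f x - a)) ∂μ) := by
        congr 1
        have h2 : Integrable (fun x => f x - a) μ := hf.sub (integrable_const a)
        rw [integral_const_mul, integral_add (integrable_const 1) h2,
          integral_sub hf (integrable_const a)]
        simp [← ha]
    _ ≤ ∫⁻ x, ENNReal.ofReal (Real.exp a * (1 + (f x - a))) ∂μ := by
        rw [integral_eq_lintegral_pos_part_sub_lintegral_neg_part hi]
        refine (ENNReal.ofReal_le_ofReal (sub_le_self _ ENNReal.toReal_nonneg)).trans ?_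
        exact ENNReal.ofReal_toReal_le
    _ ≤ _ := lintegral_mono fun x => ENNReal.ofReal_le_ofReal (h1 x)

/-- Gaussian mixtures of exponentiated quadratic forms dominate the exponential of the form at any
point `m`, up to half the squared length of `m` and half the trace of the form. -/
lemma exp_le_lintegral_gaussianVec {Z : Type*} [MeasurableSpace Z] (ν : Measure Z)
    [IsFiniteMeasure ν] {k : ℕ} (y : Z → Fin k → ℝ) (hy : ∀ j, Measurable fun z => y z j)
    (hyb : ∃ C, ∀ z, ∑ j, y z j ^ 2 ≤ C) (a m : Fin k → ℝ) :
    ENNReal.ofReal (Real.exp (∑ j, m j * a j - (∫ z, (∑ j, m j * y z j) ^ 2 ∂ν) / 2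
        - (∫ z, ∑ j, y z j ^ 2 ∂ν) / 2 - (∑ j, m j ^ 2) / 2))
      ≤ ∫⁻ w, ENNReal.ofReal (Real.exp (∑ j, w j * a j - (∫ z, (∑ j, w j * y z j) ^ 2 ∂ν) / 2))
          ∂(gaussianVec k) := by
  obtain ⟨C, hC⟩ := hyb
  obtain ⟨N, hN⟩ : ∃ N, N = Measure.pi (fun j => gaussianReal (m j) 1) := ⟨_, rfl⟩
  have hprob : IsProbabilityMeasure N := by rw [hN]; infer_instance
  have hL2 : ∀ y : Fin k → ℝ, MemLp (fun w => ∑ j, w j * y j) 2 N := fun y => by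
    rw [hN]; exact memLp_pi_gaussianReal_sum m y
  have hE : ∀ y : Fin k → ℝ, ∫ w, ∑ j, w j * y j ∂N = ∑ j, m j * y j := fun y => by
    rw [hN]; exact integral_pi_gaussianReal_sum m y
  have hC' : ∀ (w : Fin k → ℝ) z, (∑ j, w j * y z j) ^ 2 ≤ (∑ j, w j ^ 2) * C := fun w z =>
    (Finset.sum_mul_sq_le_sq_mul_sq _ _ _).trans
      (mul_le_mul_of_nonneg_left (hC z) (Finset.sum_nonneg fun _ _ => sq_nonneg _))
  have hw2 : Integrable (fun w : Fin k → ℝ => ∑ j, w j ^ 2) N := by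
    refine integrable_finsetSum _ fun j _ => ?_
    have := (hL2 (Pi.single j 1)).integrable_sq
    simpa [Pi.single_apply] using this
  have hmeas : Measurable fun p : (Fin k → ℝ) × Z => (∑ j, p.1 j * y p.2 j) ^ 2 := by
    have h : ∀ j, Measurable fun p : (Fin k → ℝ) × Z => y p.2 j := fun j =>
      (hy j).comp measurable_snd
    fun_prop
  have hprod : Integrable (fun p : (Fin k → ℝ) × Z => (∑ j, p.1 j * y p.2 j) ^ 2) (N.prod ν) := by
    refine Integrable.mono' ((hw2.mul_const C).mul_prod (integrable_const (1 : ℝ)))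
      hmeas.aestronglyMeasurable (ae_of_all _ fun p => ?_)
    rw [Real.norm_of_nonneg (sq_nonneg _), mul_one]
    exact hC' _ _
  have hswap : ∫ w, ∫ z, (∑ j, w j * y z j) ^ 2 ∂ν ∂N
      = ∫ z, (∑ j, m j * y z j) ^ 2 ∂ν + ∫ z, ∑ j, y z j ^ 2 ∂ν := by
    rw [integral_integral_swap (μ := N) (ν := ν) (f := fun w z => (∑ j, w j * y z j) ^ 2) hprod]
    simp_rw [hN, integral_pi_gaussianReal_sum_sq]
    rw [integral_add]
    · refine Integrable.mono' (integrable_const ((∑ j, m j ^ 2) * C)) ?_ (ae_of_all _ fun z => ?_)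
      · exact (Measurable.aestronglyMeasurable (by fun_prop))
      · rw [Real.norm_of_nonneg (sq_nonneg _)]; exact hC' _ _
    · refine Integrable.mono' (integrable_const C) ?_ (ae_of_all _ fun z => ?_)
      · exact (Measurable.aestronglyMeasurable (by fun_prop))
      · rw [Real.norm_of_nonneg (Finset.sum_nonneg fun _ _ => sq_nonneg _)]; exact hC _
  have hI1 : Integrable (fun w : Fin k → ℝ => ∑ j, w j * a j) N :=
    (hL2 a).integrable (by simp)
  have hI2 : Integrable (fun w => ∫ z, (∑ j, w j * y z j) ^ 2 ∂ν) N := hprod.integral_prod_left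
  have hI3 : Integrable (fun w : Fin k → ℝ => ∑ j, (w j * m j - m j ^ 2 / 2)) N := by
    simp_rw [Finset.sum_sub_distrib]
    exact ((hL2 m).integrable (by simp)).sub (integrable_const _)
  have hI12 : Integrable (fun w : Fin k → ℝ =>
      ∑ j, w j * a j - (∫ z, (∑ j, w j * y z j) ^ 2 ∂ν) / 2) N := hI1.sub (hI2.div_const 2)
  have key := integral_exp_ge_exp_integral N (hI12.sub hI3)
  have e1 : ∫ w, ((∑ j, w j * a j - (∫ z, (∑ j, w j * y z j) ^ 2 ∂ν) / 2)
      - ∑ j, (w j * m j - m j ^ 2 / 2)) ∂N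
      = ∑ j, m j * a j - (∫ z, (∑ j, m j * y z j) ^ 2 ∂ν) / 2
        - (∫ z, ∑ j, y z j ^ 2 ∂ν) / 2 - (∑ j, m j ^ 2) / 2 := by
    rw [integral_sub hI12 hI3, integral_sub hI1 (hI2.div_const 2),
      integral_div, hswap, hE]
    simp_rw [Finset.sum_sub_distrib]
    rw [integral_sub ((hL2 m).integrable (by simp)) (integrable_const _), hE, integral_const]
    simp only [probReal_univ, one_smul, ← Finset.sum_div, ← pow_two]
    ring
  simp only [Pi.sub_apply] at key
  rw [e1] at key
  refine key.trans (le_of_eq ?_)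
  have hm2 : Measurable fun w : Fin k → ℝ => ∫ z, (∑ j, w j * y z j) ^ 2 ∂ν :=
    (hmeas.stronglyMeasurable.integral_prod_right (ν := ν)).measurable
  rw [hN, pi_gaussianReal_eq_withDensity, lintegral_withDensity_eq_lintegral_mul _
    (Measurable.ennreal_ofReal (by fun_prop)) (Measurable.ennreal_ofReal (by fun_prop))]
  refine lintegral_congr fun w => ?_
  rw [Pi.mul_apply, ← ENNReal.ofReal_mul (by positivity), ← Real.exp_add]
  congr 2
  ring

/-! ### Cholesky decompositions of positive operators -/

section Cholesky

variable {H : Type u} [NormedAddCommGroup H] [InnerProductSpace ℝ H]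

lemma inner_comm_of_isPositive {A : H →L[ℝ] H} (hA : A.IsPositive) (x y : H) :
    inner ℝ (A x) y = inner ℝ (A y) x := by
  rw [hA.inner_left_eq_inner_right, real_inner_comm]

lemma inner_sq_le_of_isPositive {A : H →L[ℝ] H} (hA : A.IsPositive) (x y : H) :
    inner ℝ (A x) y ^ 2 ≤ inner ℝ (A x) x * inner ℝ (A y) y := by
  have hB := LinearMap.BilinForm.apply_mul_apply_le_of_forall_zero_le
    ((innerₗ H).comp A.toLinearMap) (fun x => hA.inner_nonneg_left x) x y
  simp only [LinearMap.comp_apply, innerₗ_apply_apply, ContinuousLinearMap.coe_coe] at hB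
  rwa [inner_comm_of_isPositive hA y x, ← sq] at hB

lemma apply_eq_zero_of_inner_self_eq_zero {A : H →L[ℝ] H} (hA : A.IsPositive) {x : H}
    (hx : inner ℝ (A x) x = 0) : A x = 0 := by
  have := inner_sq_le_of_isPositive hA x (A x)
  rw [hx, zero_mul] at this
  have h0 : inner ℝ (A x) (A x) = 0 := by nlinarith [sq_nonneg (inner ℝ (A x) (A x))]
  exact inner_self_eq_zero.mp h0

/-- Residual operators of the Cholesky decomposition of `A` along the vectors `e 0, e 1, …`:
each step subtracts the largest rank-one operator below the residual whose range contains the image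
of `e k`. A step with `⟪A_k e_k, e_k⟫ = 0` subtracts nothing, since `0⁻¹ = 0`. -/
noncomputable def cholResidual (A : H →L[ℝ] H) (e : ℕ → H) : ℕ → H →L[ℝ] H
  | 0 => A
  | k + 1 => cholResidual A e k - (inner ℝ (cholResidual A e k (e k)) (e k))⁻¹ •
      (innerSL ℝ (cholResidual A e k (e k))).smulRight (cholResidual A e k (e k))

/-- The columns of the Cholesky factor of `A` along `e`. -/
noncomputable def cholVec (A : H →L[ℝ] H) (e : ℕ → H) (k : ℕ) : H :=
  (√(inner ℝ (cholResidual A e k (e k)) (e k)))⁻¹ • cholResidual A e k (e k)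

variable {A : H →L[ℝ] H} (e : ℕ → H)

lemma cholResidual_succ_apply_raw (A : H →L[ℝ] H) (k : ℕ) (x : H) :
    cholResidual A e (k + 1) x = cholResidual A e k x
      - (inner ℝ (cholResidual A e k (e k)) (e k))⁻¹ •
        inner ℝ (cholResidual A e k (e k)) x • cholResidual A e k (e k) := by
  simp [cholResidual]

lemma cholResidual_isPositive (hA : A.IsPositive) (k : ℕ) : (cholResidual A e k).IsPositive := by
  induction k with
  | zero => exact hA
  | succ k ih =>
    rw [ContinuousLinearMap.isPositive_iff]
    refine ⟨fun x y => ?_, fun x => ?_⟩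
    · simp only [ContinuousLinearMap.coe_coe, cholResidual_succ_apply_raw, inner_sub_left,
        inner_sub_right, real_inner_smul_left, real_inner_smul_right]
      rw [ih.inner_left_eq_inner_right x y, real_inner_comm x]
      ring
    · rw [cholResidual_succ_apply_raw, inner_sub_left, real_inner_smul_left, real_inner_smul_left]
      have h := inner_sq_le_of_isPositive ih (e k) x
      have h1 := ih.inner_nonneg_left (e k)
      have h2 := ih.inner_nonneg_left x
      rcases h1.eq_or_lt with h0 | h0
      · rw [← h0]; simpa using h2
      · rw [← sq, sub_nonneg, inv_mul_le_iff₀ h0]; exact h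

lemma cholResidual_succ_apply (hA : A.IsPositive) (k : ℕ) (x : H) :
    cholResidual A e (k + 1) x = cholResidual A e k x
      - inner ℝ (cholVec A e k) x • cholVec A e k := by
  have h := (cholResidual_isPositive e hA k).inner_nonneg_left (e k)
  rw [cholResidual_succ_apply_raw, cholVec, real_inner_smul_left, smul_smul, smul_smul]
  congr 2
  rw [show ∀ a b : ℝ, a * b * a = (a * a) * b by intros; ring, ← mul_inv, Real.mul_self_sqrt h]

lemma sum_cholVec (hA : A.IsPositive) (k : ℕ) (x : H) :
    ∑ j : Fin k, inner ℝ (cholVec A e j) x • cholVec A e j = A x - cholResidual A e k x := by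
  induction k with
  | zero => simp [cholResidual]
  | succ k ih =>
    rw [Fin.sum_univ_castSucc]
    simp only [Fin.val_castSucc, Fin.val_last, ih, cholResidual_succ_apply e hA]
    abel

lemma sum_cholVec_sq (hA : A.IsPositive) (k : ℕ) (x : H) :
    ∑ j : Fin k, inner ℝ (cholVec A e j) x ^ 2
      = inner ℝ (A x) x - inner ℝ (cholResidual A e k x) x := by
  rw [← inner_sub_left, ← sum_cholVec e hA, sum_inner]
  exact Finset.sum_congr rfl fun j _ => by rw [real_inner_smul_left, sq]

lemma sum_cholVec_sq_le (hA : A.IsPositive) (k : ℕ) (x : H) :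
    ∑ j : Fin k, inner ℝ (cholVec A e j) x ^ 2 ≤ inner ℝ (A x) x := by
  rw [sum_cholVec_sq e hA]
  linarith [(cholResidual_isPositive e hA k).inner_nonneg_left x]

lemma cholResidual_apply_eq_zero (hA : A.IsPositive) {i k : ℕ} (hik : i < k) :
    cholResidual A e k (e i) = 0 := by
  have hpos := cholResidual_isPositive e hA
  induction k, hik using Nat.le_induction with
  | base =>
    rw [cholResidual_succ_apply_raw]
    by_cases h0 : inner ℝ (cholResidual A e i (e i)) (e i) = 0
    · rw [apply_eq_zero_of_inner_self_eq_zero (hpos i) h0]; simp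
    · rw [smul_smul, inv_mul_cancel₀ h0, one_smul, sub_self]
  | succ k _ ih =>
    rw [cholResidual_succ_apply_raw, ih, (hpos k).inner_left_eq_inner_right (e k) (e i), ih]; simp

lemma norm_cholResidual_apply_le (hA : A.IsPositive) (k : ℕ) (x : H) :
    ‖cholResidual A e k x‖ ≤ ‖A‖ * ‖x‖ := by
  have hpos := cholResidual_isPositive e hA k
  have hle : ∀ y, inner ℝ (cholResidual A e k y) y ≤ ‖A‖ * ‖y‖ ^ 2 := fun y => by
    have h1 := sum_cholVec_sq e hA k y
    have h2 : 0 ≤ ∑ j : Fin k, inner ℝ (cholVec A e j) y ^ 2 :=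
      Finset.sum_nonneg fun _ _ => sq_nonneg _
    have h3 : inner ℝ (A y) y ≤ ‖A y‖ * ‖y‖ := real_inner_le_norm _ _
    have h4 : ‖A y‖ * ‖y‖ ≤ ‖A‖ * ‖y‖ * ‖y‖ := by gcongr; exact A.le_opNorm y
    nlinarith
  set r := cholResidual A e k x
  have h1 := inner_sq_le_of_isPositive hpos x r
  rw [real_inner_self_eq_norm_sq] at h1
  have h2 : (‖r‖ ^ 2) ^ 2 ≤ (‖A‖ * ‖x‖ ^ 2) * (‖A‖ * ‖r‖ ^ 2) :=
    h1.trans (mul_le_mul (hle x) (hle r) (hpos.inner_nonneg_left r) (by positivity))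
  rcases (norm_nonneg r).eq_or_lt with h0 | h0
  · rw [← h0]; positivity
  · refine le_of_sq_le_sq ?_ (by positivity)
    have h3 : 0 < ‖r‖ ^ 2 := by positivity
    refine le_of_mul_le_mul_right ?_ h3
    nlinarith

/-- The Cholesky decomposition along a dense sequence exhausts `A`. -/
lemma tendsto_cholResidual_apply (hA : A.IsPositive) (he : DenseRange e) (x : H) :
    Tendsto (fun k => cholResidual A e k x) atTop (𝓝 0) := by
  rw [Metric.tendsto_atTop]
  intro ε hε
  obtain ⟨i, hi⟩ := he.exists_dist_lt x (ε := ε / (‖A‖ + 1)) (by positivity)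
  refine ⟨i + 1, fun k hk => ?_⟩
  rw [dist_zero_right, ← sub_zero (cholResidual A e k x),
    ← cholResidual_apply_eq_zero e hA (Nat.lt_of_succ_le hk), ← map_sub]
  refine (norm_cholResidual_apply_le e hA k _).trans_lt ?_
  rw [dist_eq_norm, lt_div_iff₀ (by positivity)] at hi
  nlinarith [norm_nonneg (x - e i)]

section Measurable

variable [MeasurableSpace H] [BorelSpace H] [SecondCountableTopology H]
  {α : Type*} [MeasurableSpace α] {T : α → H →L[ℝ] H}

lemma measurable_cholResidual (hT : ∀ x, Measurable fun a => T a x) (k : ℕ) (x : H) :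
    Measurable fun a => cholResidual (T a) e k x := by
  induction k generalizing x with
  | zero => exact hT x
  | succ k ih =>
    simp only [cholResidual_succ_apply_raw]
    have h1 := ih x
    have h2 := ih (e k)
    exact h1.sub ((h2.inner measurable_const).inv.smul ((h2.inner measurable_const).smul h2))

lemma measurable_cholVec (hT : ∀ x, Measurable fun a => T a x) (k : ℕ) :
    Measurable fun a => cholVec (T a) e k := by
  have h2 := measurable_cholResidual e hT k (e k)
  exact (h2.inner measurable_const).sqrt.inv.smul h2

end Measurable

end Cholesky

/-! ### Local norms -/

section LocalNorm

variable {H : Type u} [NormedAddCommGroup H] [InnerProductSpace ℝ H] {A : H →L[ℝ] H}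

lemma localNorm_apply (hA : A.IsPositive) (x : H) :
    localNorm A (A x) = ENNReal.ofReal (√(inner ℝ (A x) x)) := by
  refine le_antisymm (iInf₂_le (f := fun y (_ : A y = A x) =>
    ENNReal.ofReal (√(inner ℝ (A x) y))) x rfl) (le_iInf₂ fun y hy => ?_)
  rw [inner_comm_of_isPositive hA, hy.symm, inner_comm_of_isPositive hA, hy]

lemma localNorm_eq_top {v : H} (hv : ∀ x, A x ≠ v) : localNorm A v = ⊤ := by
  simp [localNorm, hv]

lemma exists_of_localNorm_ne_top {v : H} (hv : localNorm A v ≠ ⊤) : ∃ x, A x = v := by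
  by_contra! h
  exact hv (localNorm_eq_top h)

lemma norm_le_localNorm (hA : A.IsPositive) (v : H) :
    ENNReal.ofReal ‖v‖ ≤ ENNReal.ofReal (√‖A‖ + 1) * localNorm A v := by
  by_cases hv : ∃ x, A x = v
  · obtain ⟨x, rfl⟩ := hv
    rw [localNorm_apply hA, ← ENNReal.ofReal_mul (by positivity)]
    refine ENNReal.ofReal_le_ofReal ?_
    refine le_trans ?_ (mul_le_mul_of_nonneg_right (le_add_of_nonneg_right zero_le_one)
      (Real.sqrt_nonneg _))
    rw [← Real.sqrt_mul (norm_nonneg A)]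
    refine Real.le_sqrt_of_sq_le ?_
    have h1 := inner_sq_le_of_isPositive hA x (A x)
    rw [real_inner_self_eq_norm_sq] at h1
    have h2 : inner ℝ (A (A x)) (A x) ≤ ‖A‖ * ‖A x‖ ^ 2 := by
      have h3 : inner ℝ (A (A x)) (A x) ≤ ‖A (A x)‖ * ‖A x‖ := real_inner_le_norm _ _
      have h4 : ‖A (A x)‖ * ‖A x‖ ≤ ‖A‖ * ‖A x‖ * ‖A x‖ := by gcongr; exact A.le_opNorm _
      nlinarith
    have h5 := hA.inner_nonneg_left x
    rcases (norm_nonneg (A x)).eq_or_lt with h0 | h0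
    · rw [← h0]; simp; positivity
    · refine le_of_mul_le_mul_right ?_ (show 0 < ‖A x‖ ^ 2 by positivity)
      nlinarith [mul_le_mul_of_nonneg_left h2 h5]
  · push Not at hv
    rw [localNorm_eq_top hv, ENNReal.mul_top]
    · exact le_top
    · rw [ne_eq, ENNReal.ofReal_eq_zero, not_le]
      positivity

/-- Vectors in the range of a positive operator, characterized by a bound on the functional
`x ↦ ⟪v, x⟫` along a dense sequence (Hahn–Banach and Riesz). -/
lemma mem_range_iff_bounded [CompleteSpace H] (hA : A.IsPositive) {e : ℕ → H} (he : DenseRange e)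
    (v : H) : (∃ x, A x = v) ↔ ∃ R : ℕ, ∀ j, |inner ℝ v (e j)| ≤ R * ‖A (e j)‖ := by
  constructor
  · rintro ⟨x, rfl⟩
    obtain ⟨R, hR⟩ := exists_nat_ge ‖x‖
    refine ⟨R, fun j => ?_⟩
    rw [hA.inner_left_eq_inner_right]
    exact (abs_real_inner_le_norm _ _).trans (by gcongr)
  · rintro ⟨R, hR⟩
    have hR' : ∀ x, |inner ℝ v x| ≤ R * ‖A x‖ := fun x =>
      he.induction_on (p := fun x => |inner ℝ v x| ≤ R * ‖A x‖) x
        (isClosed_le (by fun_prop) (by fun_prop)) hR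
    have hker : A.toLinearMap.ker ≤ (innerₗ H v).ker := fun x hx => by
      have h := hR' x
      have hx' : A x = 0 := hx
      rw [hx'] at h
      simp only [norm_zero, mul_zero, abs_nonpos_iff] at h
      exact h
    let φ : A.toLinearMap.range →ₗ[ℝ] ℝ :=
      (A.toLinearMap.ker.liftQ (innerₗ H v) hker).comp A.toLinearMap.quotKerEquivRange.symm.toLinearMap
    have hφ : ∀ x, φ ⟨A x, x, rfl⟩ = inner ℝ v x := fun x => by
      have : A.toLinearMap.quotKerEquivRange.symm ⟨A x, x, rfl⟩ = Submodule.Quotient.mk x := by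
        rw [LinearEquiv.symm_apply_eq]; rfl
      simp [φ, this]
    let ψ : A.toLinearMap.range →L[ℝ] ℝ := φ.mkContinuous R (by
      rintro ⟨_, x, rfl⟩
      have := hφ x
      simp only [ContinuousLinearMap.coe_coe] at this ⊢
      rw [this]
      exact hR' x)
    obtain ⟨g, hg, -⟩ := exists_extension_norm_eq _ ψ
    refine ⟨(InnerProductSpace.toDual ℝ H).symm g, ext_inner_right ℝ fun x => ?_⟩
    rw [hA.inner_left_eq_inner_right, InnerProductSpace.toDual_symm_apply]
    exact (hg ⟨A x, x, rfl⟩).trans (hφ x)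

lemma localNorm_sq_eq_iSup (hA : A.IsPositive) {e : ℕ → H} (he : DenseRange e) (x : H) :
    localNorm A (A x) ^ 2
      = ⨆ j, ENNReal.ofReal (2 * inner ℝ (A x) (e j) - inner ℝ (A (e j)) (e j)) := by
  have hx := hA.inner_nonneg_left x
  rw [localNorm_apply hA, ← ENNReal.ofReal_pow (by positivity), Real.sq_sqrt hx]
  have hle : ∀ y, 2 * inner ℝ (A x) y - inner ℝ (A y) y ≤ inner ℝ (A x) x := fun y => by
    have h := hA.inner_nonneg_left (x - y)
    rw [map_sub, inner_sub_left, inner_sub_right, inner_sub_right,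
      inner_comm_of_isPositive hA y x] at h
    linarith
  refine le_antisymm ?_ (iSup_le fun j => ENNReal.ofReal_le_ofReal (hle _))
  have hcl : IsClosed {y : H | ENNReal.ofReal (2 * inner ℝ (A x) y - inner ℝ (A y) y)
      ≤ ⨆ j, ENNReal.ofReal (2 * inner ℝ (A x) (e j) - inner ℝ (A (e j)) (e j))} :=
    isClosed_le (ENNReal.continuous_ofReal.comp (by fun_prop)) continuous_const
  have h := he.induction_on (p := fun y => ENNReal.ofReal (2 * inner ℝ (A x) y - inner ℝ (A y) y)
      ≤ ⨆ j, ENNReal.ofReal (2 * inner ℝ (A x) (e j) - inner ℝ (A (e j)) (e j))) x hcl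
    (fun j => le_iSup (fun j => ENNReal.ofReal (2 * inner ℝ (A x) (e j) - inner ℝ (A (e j)) (e j))) j)
  rwa [two_mul, add_sub_cancel_right] at h

/-- Joint measurability of the local norms. -/
lemma measurable_localNorm [CompleteSpace H] [MeasurableSpace H] [BorelSpace H]
    [SecondCountableTopology H] {α : Type*} [MeasurableSpace α] {T : α → H →L[ℝ] H}
    (hT : ∀ x, Measurable fun a => T a x) (hpos : ∀ a, (T a).IsPositive) :
    Measurable fun p : α × H => localNorm (T p.1) p.2 := by
  classical
  set e := TopologicalSpace.denseSeq H
  have he : DenseRange e := TopologicalSpace.denseRange_denseSeq H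
  have hT' : ∀ j, Measurable fun p : α × H => T p.1 (e j) := fun j => (hT _).comp measurable_fst
  have h2 : ∀ j, Measurable fun p : α × H => inner ℝ p.2 (e j) :=
    fun j => measurable_snd.inner measurable_const
  have hS : MeasurableSet {p : α × H | ∃ x, T p.1 x = p.2} := by
    simp_rw [fun p : α × H => mem_range_iff_bounded (hpos p.1) he p.2]
    simp only [ofPred_exists, ofPred_forall]
    exact .iUnion fun R => .iInter fun j =>
      measurableSet_le (continuous_abs.measurable.comp (h2 j)) ((hT' j).norm.const_mul _)
  have hM : Measurable fun p : α × H => (⨆ j, ENNReal.ofReal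
      (2 * inner ℝ p.2 (e j) - inner ℝ (T p.1 (e j)) (e j))) ^ (1 / 2 : ℝ) :=
    (Measurable.iSup fun j => (((h2 j).const_mul 2).sub
      ((hT' j).inner measurable_const)).ennreal_ofReal).pow_const _
  have hfun : (fun p : α × H => localNorm (T p.1) p.2) = fun p => if ∃ x, T p.1 x = p.2 then
      (⨆ j, ENNReal.ofReal (2 * inner ℝ p.2 (e j) - inner ℝ (T p.1 (e j)) (e j))) ^ (1 / 2 : ℝ)
      else ⊤ := by
    funext p
    split_ifs with h
    · obtain ⟨x, hx⟩ := h
      rw [← hx, ← localNorm_sq_eq_iSup (hpos p.1) he, ← ENNReal.rpow_natCast, ← ENNReal.rpow_mul]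
      norm_num
    · exact localNorm_eq_top (by push Not at h; exact h)
  rw [hfun]
  exact Measurable.ite hS hM measurable_const

end LocalNorm

/-! ### Self-normalized exponential moments -/

lemma exp_sub_sq_le (x : ℝ) : Real.exp (x - x ^ 2 / 2) ≤ 1 + x + x ^ 2 / 2 := by
  -- the logarithm of the right side minus the exponent has derivative of the sign of `x`
  have hpos : ∀ x : ℝ, 0 < 1 + x + x ^ 2 / 2 := fun x => by nlinarith [sq_nonneg (x + 1)]
  have hderiv : ∀ x : ℝ, HasDerivAt (fun x : ℝ => (1 + x + x ^ 2 / 2) * Real.exp (x ^ 2 / 2 - x))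
      (x * (1 + x / 2 + x ^ 2 / 2) * Real.exp (x ^ 2 / 2 - x)) x := fun x => by
    have h1 : HasDerivAt (fun x : ℝ => 1 + x + x ^ 2 / 2) (1 + x) x := by
      have : HasDerivAt (fun x : ℝ => 1 + x + x ^ 2 / 2) _ x :=
        ((hasDerivAt_id x).const_add 1).add ((hasDerivAt_pow 2 x).div_const 2)
      exact this.congr_deriv (by norm_num)
    have h2 : HasDerivAt (fun x : ℝ => x ^ 2 / 2 - x) (x - 1) x := by
      have : HasDerivAt (fun x : ℝ => x ^ 2 / 2 - x) _ x :=
        ((hasDerivAt_pow 2 x).div_const 2).sub (hasDerivAt_id x)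
      exact this.congr_deriv (by norm_num)
    exact (h1.mul h2.exp).congr_deriv (by ring)
  have hq : ∀ x : ℝ, 0 < 1 + x / 2 + x ^ 2 / 2 := fun x => by nlinarith [sq_nonneg (x + 1 / 2)]
  set φ : ℝ → ℝ := fun x => (1 + x + x ^ 2 / 2) * Real.exp (x ^ 2 / 2 - x) with hφ
  have hcont : Continuous φ := by fun_prop
  have h1 : 1 ≤ φ x := by
    have h0 : φ 0 = 1 := by simp [hφ]
    rw [← h0]
    rcases le_total 0 x with hx | hx
    · refine monotoneOn_of_deriv_nonneg (convex_Ici 0) hcont.continuousOn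
        (fun y _ => (hderiv y).differentiableAt.differentiableWithinAt) (fun y hy => ?_)
        (mem_Ici.mpr le_rfl) (mem_Ici.mpr hx) hx
      rw [interior_Ici, mem_Ioi] at hy
      rw [(hderiv y).deriv]
      have := hq y
      positivity
    · refine antitoneOn_of_deriv_nonpos (convex_Iic 0) hcont.continuousOn
        (fun y _ => (hderiv y).differentiableAt.differentiableWithinAt) (fun y hy => ?_)
        (mem_Iic.mpr hx) (mem_Iic.mpr le_rfl) hx
      rw [interior_Iic, mem_Iio] at hy
      rw [(hderiv y).deriv]
      have := hq y
      exact mul_nonpos_of_nonpos_of_nonneg (mul_nonpos_of_nonpos_of_nonneg hy.le this.le)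
        (Real.exp_nonneg _)
  have h2 : Real.exp (x - x ^ 2 / 2) * Real.exp (x ^ 2 / 2 - x) = 1 := by
    rw [← Real.exp_add]; simp
  refine le_of_mul_le_mul_right (h2.trans_le h1) (Real.exp_pos _)

section Exponent

variable {Z : Type v} [MeasurableSpace Z] (P : Measure Z)

/-- The self-normalized exponent of the empirical sum of `X`: the sum over the sample of
`X - X² / 2 - P X - P X² / 2`. -/
noncomputable def empExponent {n : ℕ} (S : Fin n → Z) (X : Z → ℝ) : ℝ :=
  ∑ i, (X (S i) - X (S i) ^ 2 / 2 - ∫ z, X z ∂P - (∫ z, X z ^ 2 ∂P) / 2)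

variable [IsProbabilityMeasure P]

lemma lintegral_exp_le_one {X : Z → ℝ} (hX : Measurable X) {C : ℝ} (hC : ∀ z, |X z| ≤ C) :
    ∫⁻ z, ENNReal.ofReal
      (Real.exp (X z - X z ^ 2 / 2 - ∫ z, X z ∂P - (∫ z, X z ^ 2 ∂P) / 2)) ∂P ≤ 1 := by
  have hi1 : Integrable X P := Integrable.mono' (integrable_const C) hX.aestronglyMeasurable
    (ae_of_all _ fun z => hC z)
  have hi2 : Integrable (fun z => X z ^ 2) P := Integrable.mono' (integrable_const (C ^ 2))
    (hX.pow_const 2).aestronglyMeasurable (ae_of_all _ fun z => by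
      rw [Real.norm_of_nonneg (sq_nonneg _)]; exact sq_le_sq.mpr ((hC z).trans (le_abs_self C)))
  set a := ∫ z, X z ∂P
  set b := ∫ z, X z ^ 2 ∂P
  have hi3 : Integrable (fun z => 1 + X z + X z ^ 2 / 2) P :=
    ((integrable_const 1).add hi1).add (hi2.div_const 2)
  have hint : ∫ z, (1 + X z + X z ^ 2 / 2) ∂P = 1 + a + b / 2 := by
    have h1 : Integrable (fun z => 1 + X z) P := (integrable_const 1).add hi1
    rw [integral_add h1 (hi2.div_const 2), integral_add (integrable_const 1) hi1, integral_div]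
    simp [a, b]
  calc _ ≤ ∫⁻ z, ENNReal.ofReal (Real.exp (-(a + b / 2)))
          * ENNReal.ofReal (1 + X z + X z ^ 2 / 2) ∂P := by
        refine lintegral_mono fun z => ?_
        rw [← ENNReal.ofReal_mul (by positivity)]
        refine ENNReal.ofReal_le_ofReal ?_
        rw [show X z - X z ^ 2 / 2 - a - b / 2 = -(a + b / 2) + (X z - X z ^ 2 / 2) by ring,
          Real.exp_add]
        gcongr
        exact exp_sub_sq_le _
    _ = ENNReal.ofReal (Real.exp (-(a + b / 2))) * ENNReal.ofReal (1 + a + b / 2) := by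
        rw [lintegral_const_mul _ (by fun_prop), ← hint, ofReal_integral_eq_lintegral_ofReal hi3]
        exact ae_of_all _ fun z => by
          show 0 ≤ 1 + X z + X z ^ 2 / 2
          nlinarith [sq_nonneg (X z + 1)]
    _ ≤ 1 := by
        rw [← ENNReal.ofReal_mul (by positivity), ← ENNReal.ofReal_one]
        refine ENNReal.ofReal_le_ofReal ?_
        calc _ ≤ Real.exp (-(a + b / 2)) * Real.exp (a + b / 2) := by
              gcongr; linarith [Real.add_one_le_exp (a + b / 2)]
          _ = 1 := by rw [← Real.exp_add]; simp

lemma lintegral_exp_empExponent_le_one {X : Z → ℝ} (hX : Measurable X) {C : ℝ}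
    (hC : ∀ z, |X z| ≤ C) (n : ℕ) :
    ∫⁻ S, ENNReal.ofReal (Real.exp (empExponent P S X)) ∂(Measure.pi fun _ : Fin n => P) ≤ 1 := by
  simp_rw [empExponent, Real.exp_sum,
    fun S : Fin n → Z => ENNReal.ofReal_prod_of_nonneg (s := Finset.univ)
      (f := fun i => Real.exp (X (S i) - X (S i) ^ 2 / 2 - ∫ z, X z ∂P - (∫ z, X z ^ 2 ∂P) / 2))
      (fun _ _ => by positivity)]
  rw [lintegral_pi_prod (fun _ : Fin n => P) (fun _ z => ENNReal.ofReal
    (Real.exp (X z - X z ^ 2 / 2 - ∫ z, X z ∂P - (∫ z, X z ^ 2 ∂P) / 2))) (fun _ => by fun_prop)]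
  exact Finset.prod_le_one' fun _ _ => lintegral_exp_le_one P hX hC

end Exponent

/-! ### Gaussian mixtures over all directions -/

section Mixture

variable {H : Type u} [NormedAddCommGroup H] [InnerProductSpace ℝ H]
  {Z : Type v} [MeasurableSpace Z] (P : Measure Z)

/-- The Gaussian mixture, over the directions spanned by the first `k` Cholesky vectors of `A`,
of the exponentials of the self-normalized exponents of `z ↦ ⟪direction, g z⟫`; `s` is the variance
of the mixing Gaussian. -/
noncomputable def gaussianMixture (e : ℕ → H) (s : ℝ) (k : ℕ) (A : H →L[ℝ] H) (g : Z → H) {n : ℕ}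
    (S : Fin n → Z) : ℝ≥0∞ :=
  ∫⁻ w, ENNReal.ofReal (Real.exp (empExponent P S
    fun z => ∑ j : Fin k, w j * (√s * inner ℝ (cholVec A e j) (g z)))) ∂(gaussianVec k)

/-- The limit inferior of the Gaussian mixtures over more and more directions. -/
noncomputable def limitMixture (e : ℕ → H) (s : ℝ) (A : H →L[ℝ] H) (g : Z → H) {n : ℕ}
    (S : Fin n → Z) : ℝ≥0∞ :=
  liminf (fun k => gaussianMixture P e s k A g S) atTop

variable {P} {e : ℕ → H} {s : ℝ} {A : H →L[ℝ] H} {g : Z → H} {M : ℝ}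

lemma sq_cholVec_le {Z : Type v} {g : Z → H} (hA : A.IsPositive) (hs : 0 ≤ s)
    (hgM : ∀ z, inner ℝ (A (g z)) (g z) ≤ M ^ 2) (k : ℕ) (z : Z) :
    ∑ j : Fin k, (√s * inner ℝ (cholVec A e j) (g z)) ^ 2 ≤ s * M ^ 2 := by
  simp_rw [mul_pow, Real.sq_sqrt hs, ← Finset.mul_sum]
  exact mul_le_mul_of_nonneg_left ((sum_cholVec_sq_le e hA k _).trans (hgM z)) hs

lemma exists_measure_integral_eq {Z : Type v} [MeasurableSpace Z] (P : Measure Z)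
    [IsProbabilityMeasure P] {n : ℕ} (S : Fin n → Z) :
    ∃ ν : Measure Z, IsFiniteMeasure ν ∧ ∀ f : Z → ℝ, Measurable f → Integrable f P →
      ∫ z, f z ∂ν = ∑ i, f (S i) + n * ∫ z, f z ∂P := by
  have : IsFiniteMeasure ((n : ℝ≥0∞) • P) := Measure.smul_finite P (by simp)
  refine ⟨∑ i, Measure.dirac (S i) + (n : ℝ≥0∞) • P, inferInstance, fun f hfm hf => ?_⟩
  have hd : ∀ i, Integrable f (Measure.dirac (S i)) := fun i =>
    integrable_dirac' hfm.stronglyMeasurable (by simp [enorm_lt_top])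
  rw [integral_add_measure (integrable_finsetSum_measure.mpr fun i _ => hd i)
    (hf.smul_measure (by simp)), integral_finsetSum_measure fun i _ => hd i, integral_smul_measure]
  simp [integral_dirac' f _ hfm.stronglyMeasurable]

variable [IsProbabilityMeasure P]

lemma exp_le_gaussianMixture (hA : A.IsPositive) (hs : 0 < s)
    (hg : ∀ x, Measurable fun z => inner ℝ x (g z))
    (hgM : ∀ z, inner ℝ (A (g z)) (g z) ≤ M ^ 2) (k : ℕ) (lam : ℝ) (x : H) {n : ℕ}
    (S : Fin n → Z) :
    ENNReal.ofReal (Real.exp (empExponent P S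
      (fun z => lam * inner ℝ (A x - cholResidual A e k x) (g z))
        - n * s * M ^ 2 - lam ^ 2 * inner ℝ (A x) x / (2 * s)))
      ≤ gaussianMixture P e s k A g S := by
  set y : Z → Fin k → ℝ := fun z j => √s * inner ℝ (cholVec A e j) (g z) with hy_def
  set m : Fin k → ℝ := fun j => lam / √s * inner ℝ (cholVec A e j) x with hm_def
  have hs' : √s ≠ 0 := (Real.sqrt_pos.mpr hs).ne'
  have hy : ∀ j, Measurable fun z => y z j := fun j => (hg _).const_mul _
  have hyb : ∀ z, ∑ j, y z j ^ 2 ≤ s * M ^ 2 := sq_cholVec_le hA hs.le hgM k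
  have hsum : ∀ z, ∑ j, m j * y z j = lam * inner ℝ (A x - cholResidual A e k x) (g z) := by
    intro z
    rw [← sum_cholVec e hA, sum_inner, Finset.mul_sum]
    refine Finset.sum_congr rfl fun j _ => ?_
    rw [real_inner_smul_left]
    simp only [hm_def, hy_def]
    field_simp
  have hm2 : ∑ j, m j ^ 2 ≤ lam ^ 2 * inner ℝ (A x) x / s := by
    simp only [hm_def, mul_pow, div_pow, Real.sq_sqrt hs.le, ← Finset.mul_sum]
    rw [mul_div_right_comm]
    exact mul_le_mul_of_nonneg_left (sum_cholVec_sq_le e hA k x) (by positivity)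
  have hbd : ∀ (w : Fin k → ℝ) z, (∑ j, w j * y z j) ^ 2 ≤ (∑ j, w j ^ 2) * (s * M ^ 2) :=
    fun w z => (Finset.sum_mul_sq_le_sq_mul_sq _ _ _).trans
      (mul_le_mul_of_nonneg_left (hyb z) (Finset.sum_nonneg fun _ _ => sq_nonneg _))
  have hsq : ∀ w : Fin k → ℝ, Integrable (fun z => (∑ j, w j * y z j) ^ 2) P := fun w =>
    Integrable.mono' (integrable_const ((∑ j, w j ^ 2) * (s * M ^ 2)))
      (Measurable.aestronglyMeasurable (by fun_prop))
      (ae_of_all _ fun z => by rw [Real.norm_of_nonneg (sq_nonneg _)]; exact hbd w z)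
  have hys : Integrable (fun z => ∑ j, y z j ^ 2) P :=
    Integrable.mono' (integrable_const (s * M ^ 2))
      (Measurable.aestronglyMeasurable (by fun_prop))
      (ae_of_all _ fun z => by
        rw [Real.norm_of_nonneg (Finset.sum_nonneg fun _ _ => sq_nonneg _)]; exact hyb z)
  have hyi : ∀ j, Integrable (fun z => y z j) P := fun j => by
    refine Integrable.mono' (integrable_const (√(s * M ^ 2))) (hy j).aestronglyMeasurable
      (ae_of_all _ fun z => ?_)
    rw [Real.norm_eq_abs, ← Real.sqrt_sq_eq_abs]
    exact Real.sqrt_le_sqrt ((Finset.single_le_sum (f := fun j => y z j ^ 2)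
      (fun _ _ => sq_nonneg _) (Finset.mem_univ j)).trans (hyb z))
  -- the quadratic part of the exponent is an integral against the measure `ν`
  obtain ⟨ν, hfin, hνint⟩ := exists_measure_integral_eq P S
  have key := exp_le_lintegral_gaussianVec ν y hy ⟨_, hyb⟩
    (fun j => ∑ i, y (S i) j - n * ∫ z, y z j ∂P) m
  have hexp : ∀ w : Fin k → ℝ, empExponent P S (fun z => ∑ j, w j * y z j)
      = ∑ j, w j * (∑ i, y (S i) j - n * ∫ z, y z j ∂P) - (∫ z, (∑ j, w j * y z j) ^ 2 ∂ν) / 2 := by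
    intro w
    rw [hνint _ (by fun_prop) (hsq w), empExponent]
    simp only [Finset.sum_sub_distrib, Finset.sum_const, Finset.card_univ, Fintype.card_fin,
      nsmul_eq_mul, mul_sub, ← Finset.sum_div]
    rw [integral_finsetSum _ fun j _ => (hyi j).const_mul (w j)]
    simp only [integral_const_mul, Finset.mul_sum]
    rw [Finset.sum_comm]
    have : ∀ j, w j * (n * ∫ z, y z j ∂P) = n * (w j * ∫ z, y z j ∂P) := fun j => by ring
    simp only [this]
    ring
  have hmix : gaussianMixture P e s k A g S = ∫⁻ w, ENNReal.ofReal (Real.exp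
      (∑ j, w j * (∑ i, y (S i) j - n * ∫ z, y z j ∂P) - (∫ z, (∑ j, w j * y z j) ^ 2 ∂ν) / 2))
      ∂(gaussianVec k) :=
    lintegral_congr fun w => by rw [← hexp w]
  rw [hmix]
  refine le_trans (ENNReal.ofReal_le_ofReal (Real.exp_le_exp.mpr ?_)) key
  have h1 := hexp m
  rw [← funext hsum, h1, hνint _ (by fun_prop) hys]
  have h2 : ∑ i, ∑ j, y (S i) j ^ 2 ≤ n * (s * M ^ 2) := by
    refine (Finset.sum_le_sum fun i _ => hyb (S i)).trans ?_
    simp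
  have h3 : ∫ z, ∑ j, y z j ^ 2 ∂P ≤ s * M ^ 2 :=
    (integral_mono hys (integrable_const _) hyb).trans (by simp)
  have h4 : (n : ℝ) * ∫ z, ∑ j, y z j ^ 2 ∂P ≤ n * (s * M ^ 2) := by gcongr
  have h5 : lam ^ 2 * inner ℝ (A x) x / (2 * s) = lam ^ 2 * inner ℝ (A x) x / s / 2 := by
    rw [div_div, mul_comm s]
  rw [h5]
  linarith

/-- Lower bound of the limit mixture at any direction `A x` in the range of `A`. -/
lemma exp_le_limitMixture (hA : A.IsPositive) (he : DenseRange e) (hs : 0 < s)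
    (hg : ∀ x, Measurable fun z => inner ℝ x (g z))
    (hgM : ∀ z, inner ℝ (A (g z)) (g z) ≤ M ^ 2) (lam : ℝ) (x : H) {n : ℕ} (S : Fin n → Z) :
    ENNReal.ofReal (Real.exp (empExponent P S (fun z => lam * inner ℝ (A x) (g z))
        - n * s * M ^ 2 - lam ^ 2 * inner ℝ (A x) x / (2 * s)))
      ≤ limitMixture P e s A g S := by
  have hlim : ∀ z, Tendsto (fun k => lam * inner ℝ (A x - cholResidual A e k x) (g z)) atTop
      (𝓝 (lam * inner ℝ (A x) (g z))) := fun z => by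
    have := (tendsto_const_nhds (x := A x)).sub (tendsto_cholResidual_apply e hA he x)
    rw [sub_zero] at this
    exact (this.inner tendsto_const_nhds).const_mul lam
  have hsqb : ∀ k z, (lam * inner ℝ (A x - cholResidual A e k x) (g z)) ^ 2
      ≤ lam ^ 2 * (inner ℝ (A x) x * M ^ 2) := by
    intro k z
    rw [mul_pow]
    refine mul_le_mul_of_nonneg_left ?_ (sq_nonneg _)
    rw [← sum_cholVec e hA, sum_inner]
    simp_rw [real_inner_smul_left]
    refine (Finset.sum_mul_sq_le_sq_mul_sq _ _ _).trans ?_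
    exact mul_le_mul (sum_cholVec_sq_le e hA k x) ((sum_cholVec_sq_le e hA k _).trans (hgM z))
      (Finset.sum_nonneg fun _ _ => sq_nonneg _) (hA.inner_nonneg_left x)
  have hP1 : Tendsto (fun k => ∫ z, lam * inner ℝ (A x - cholResidual A e k x) (g z) ∂P) atTop
      (𝓝 (∫ z, lam * inner ℝ (A x) (g z) ∂P)) := by
    refine tendsto_integral_of_dominated_convergence
      (fun _ => √(lam ^ 2 * (inner ℝ (A x) x * M ^ 2)))
      (fun k => ((hg _).const_mul lam).aestronglyMeasurable) (integrable_const _)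
      (fun k => ae_of_all _ fun z => ?_) (ae_of_all _ hlim)
    rw [Real.norm_eq_abs, ← Real.sqrt_sq_eq_abs]
    exact Real.sqrt_le_sqrt (hsqb k z)
  have hP2 : Tendsto (fun k => ∫ z, (lam * inner ℝ (A x - cholResidual A e k x) (g z)) ^ 2 ∂P) atTop
      (𝓝 (∫ z, (lam * inner ℝ (A x) (g z)) ^ 2 ∂P)) := by
    refine tendsto_integral_of_dominated_convergence
      (fun _ => lam ^ 2 * (inner ℝ (A x) x * M ^ 2))
      (fun k => (((hg _).const_mul lam).pow_const 2).aestronglyMeasurable) (integrable_const _)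
      (fun k => ae_of_all _ fun z => ?_) (ae_of_all _ fun z => (hlim z).pow 2)
    rw [Real.norm_of_nonneg (sq_nonneg _)]
    exact hsqb k z
  have hE : Tendsto (fun k => empExponent P S
      (fun z => lam * inner ℝ (A x - cholResidual A e k x) (g z))) atTop
      (𝓝 (empExponent P S (fun z => lam * inner ℝ (A x) (g z)))) := by
    refine tendsto_finsetSum _ fun i _ => ?_
    exact (((hlim _).sub (((hlim _).pow 2).div_const 2)).sub hP1).sub (hP2.div_const 2)
  have hT := (ENNReal.continuous_ofReal.tendsto _).comp ((Real.continuous_exp.tendsto _).comp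
    ((hE.sub_const (n * s * M ^ 2)).sub_const (lam ^ 2 * inner ℝ (A x) x / (2 * s))))
  rw [← hT.liminf_eq]
  exact liminf_le_liminf (Eventually.of_forall fun k => exp_le_gaussianMixture hA hs hg hgM k lam x S)

section Measurable

variable [MeasurableSpace H] [BorelSpace H] [SecondCountableTopology H]
  {T : H → H →L[ℝ] H} {G : H → Z → H}

/-- For a weakly measurable `G`, inner products with measurable vector fields are measurable:
`⟪x, G p⟫` is continuous in `x` and measurable in `p`. -/
lemma measurable_inner_of_weak {α : Type*} [MeasurableSpace α] {G : α → Z → H}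
    (hG : ∀ x, Measurable fun p : α × Z => inner ℝ x (G p.1 p.2)) {u : α → H} (hu : Measurable u) :
    Measurable fun p : α × Z => inner ℝ (u p.1) (G p.1 p.2) := by
  have h := measurable_uncurry_of_continuous_of_measurable
    (u := fun (x : H) (p : α × Z) => inner ℝ x (G p.1 p.2)) (fun p => by fun_prop) hG
  exact h.comp ((hu.comp measurable_fst).prodMk measurable_id)

lemma measurable_gaussianExponent (hT : ∀ x, Measurable fun f => T f x)
    (hG : ∀ x, Measurable fun p : H × Z => inner ℝ x (G p.1 p.2)) (k n : ℕ) :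
    Measurable fun q : (H × (Fin n → Z)) × (Fin k → ℝ) => empExponent P q.1.2
      fun z => ∑ j : Fin k, q.2 j * (√s * inner ℝ (cholVec (T q.1.1) e j) (G q.1.1 z)) := by
  have hX : Measurable fun r : (H × (Fin k → ℝ)) × Z =>
      ∑ j : Fin k, r.1.2 j * (√s * inner ℝ (cholVec (T r.1.1) e j) (G r.1.1 r.2)) := by
    refine Finset.measurable_sum _ fun j _ => ?_
    have h1 := measurable_inner_of_weak hG (measurable_cholVec e hT j)
    have h2 : Measurable fun r : (H × (Fin k → ℝ)) × Z => (r.1.1, r.2) := by fun_prop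
    have h3 : Measurable fun r : (H × (Fin k → ℝ)) × Z => r.1.2 j := by fun_prop
    exact h3.mul ((h1.comp h2).const_mul _)
  have hI1 := (hX.stronglyMeasurable.integral_prod_right' (ν := P)).measurable
  have hI2 := ((hX.pow_const 2).stronglyMeasurable.integral_prod_right' (ν := P)).measurable
  have hp : Measurable fun q : (H × (Fin n → Z)) × (Fin k → ℝ) => (q.1.1, q.2) := by fun_prop
  refine Finset.measurable_sum _ fun i _ => ?_
  have hXi := hX.comp (hp.prodMk (show Measurable fun q : (H × (Fin n → Z)) × (Fin k → ℝ) => q.1.2 i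
    by fun_prop))
  exact ((hXi.sub ((hXi.pow_const 2).div_const 2)).sub (hI1.comp hp)).sub ((hI2.comp hp).div_const 2)

lemma measurable_gaussianMixture (hT : ∀ x, Measurable fun f => T f x)
    (hG : ∀ x, Measurable fun p : H × Z => inner ℝ x (G p.1 p.2)) (k n : ℕ) :
    Measurable fun q : H × (Fin n → Z) => gaussianMixture P e s k (T q.1) (G q.1) q.2 :=
  have h := (measurable_gaussianExponent (P := P) (e := e) (s := s) hT hG k n).exp.ennreal_ofReal
  h.lintegral_prod_right'

lemma measurable_limitMixture (hT : ∀ x, Measurable fun f => T f x)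
    (hG : ∀ x, Measurable fun p : H × Z => inner ℝ x (G p.1 p.2)) (n : ℕ) :
    Measurable fun q : H × (Fin n → Z) => limitMixture P e s (T q.1) (G q.1) q.2 :=
  Measurable.liminf fun k => measurable_gaussianMixture hT hG k n

lemma lintegral_gaussianMixture_le_one (hT : ∀ x, Measurable fun f => T f x)
    (hG : ∀ x, Measurable fun p : H × Z => inner ℝ x (G p.1 p.2)) (hpos : ∀ f, (T f).IsPositive)
    (hs : 0 ≤ s) (hGM : ∀ f z, inner ℝ (T f (G f z)) (G f z) ≤ M ^ 2) (k n : ℕ) (f : H) :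
    ∫⁻ S, gaussianMixture P e s k (T f) (G f) S ∂(Measure.pi fun _ : Fin n => P) ≤ 1 := by
  have hm : Measurable fun r : (Fin n → Z) × (Fin k → ℝ) => ENNReal.ofReal (Real.exp
      (empExponent P r.1 fun z =>
        ∑ j : Fin k, r.2 j * (√s * inner ℝ (cholVec (T f) e j) (G f z)))) :=
    ((measurable_gaussianExponent (P := P) (e := e) (s := s) hT hG k n).comp
      (show Measurable fun r : (Fin n → Z) × (Fin k → ℝ) => ((f, r.1), r.2) by
        fun_prop)).exp.ennreal_ofReal
  simp only [gaussianMixture]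
  rw [lintegral_lintegral_swap (f := fun (S : Fin n → Z) (w : Fin k → ℝ) => ENNReal.ofReal
    (Real.exp (empExponent P S fun z =>
      ∑ j : Fin k, w j * (√s * inner ℝ (cholVec (T f) e j) (G f z))))) hm.aemeasurable]
  calc _ ≤ ∫⁻ _ : Fin k → ℝ, 1 ∂(gaussianVec k) := by
        refine lintegral_mono fun w => ?_
        refine lintegral_exp_empExponent_le_one P (C := √((∑ j, w j ^ 2) * (s * M ^ 2))) ?_ ?_ n
        · refine Finset.measurable_sum _ fun j _ => ((Measurable.const_mul ?_ _).const_mul _)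
          exact (hG (cholVec (T f) e j)).comp measurable_prodMk_left
        · intro z
          rw [← Real.sqrt_sq_eq_abs]
          refine Real.sqrt_le_sqrt ((Finset.sum_mul_sq_le_sq_mul_sq _ _ _).trans ?_)
          exact mul_le_mul_of_nonneg_left (sq_cholVec_le (hpos f) hs (hGM f) k z)
            (Finset.sum_nonneg fun _ _ => sq_nonneg _)
    _ = 1 := by simp

/-- The limit mixtures have expectation at most one over the sample, for any prior. -/
lemma lintegral_limitMixture_le_one (hT : ∀ x, Measurable fun f => T f x)
    (hG : ∀ x, Measurable fun p : H × Z => inner ℝ x (G p.1 p.2)) (hpos : ∀ f, (T f).IsPositive)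
    (hs : 0 ≤ s) (hGM : ∀ f z, inner ℝ (T f (G f z)) (G f z) ≤ M ^ 2) (n : ℕ) (U : Measure H)
    [IsProbabilityMeasure U] :
    ∫⁻ S, ∫⁻ f, limitMixture P e s (T f) (G f) S ∂U ∂(Measure.pi fun _ : Fin n => P) ≤ 1 := by
  rw [lintegral_lintegral_swap (f := fun S f => limitMixture P e s (T f) (G f) S)
    ((measurable_limitMixture hT hG n).comp measurable_swap).aemeasurable]
  calc _ ≤ ∫⁻ _ : H, 1 ∂U := by
        refine lintegral_mono fun f => ?_
        refine (lintegral_liminf_le fun k => (measurable_gaussianMixture hT hG k n).comp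
          measurable_prodMk_left).trans ?_
        refine liminf_le_of_le (by isBoundedDefault) fun b hb => ?_
        obtain ⟨k, hk⟩ := hb.exists
        exact hk.trans (lintegral_gaussianMixture_le_one hT hG hpos hs hGM k n f)
    _ = 1 := by simp

end Measurable

end Mixture

/-! ### The Donsker–Varadhan inequality and the choice of the mixing variance -/

/-- The Donsker–Varadhan inequality, for a function `h` whose exponential is dominated by a function
`G` with a bounded prior integral. -/
lemma integral_le_klDiv_add_log {H : Type*} [MeasurableSpace H] {Q U : Measure H}
    [IsProbabilityMeasure Q] [IsProbabilityMeasure U] {G : H → ℝ≥0∞} (hG : Measurable G)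
    {h : H → ℝ} (hh : Integrable h Q) (hle : ∀ᵐ f ∂Q, ENNReal.ofReal (Real.exp (h f)) ≤ G f)
    {C : ℝ} (hC : 0 < C) (hGC : ∫⁻ f, G f ∂U ≤ ENNReal.ofReal C)
    (hkl : InformationTheory.klDiv Q U ≠ ⊤) :
    ∫ f, h f ∂Q ≤ (InformationTheory.klDiv Q U).toReal + Real.log C := by
  obtain ⟨hac, hllr⟩ := InformationTheory.klDiv_ne_top_iff.mp hkl
  rw [InformationTheory.toReal_klDiv_of_measure_eq hac (by simp)]
  have hint : Integrable (fun f => h f - llr Q U f) Q := hh.sub hllr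
  have hJ := integral_exp_ge_exp_integral Q hint
  rw [integral_sub hh hllr] at hJ
  have hρ : Measurable (Q.rnDeriv U) := Measure.measurable_rnDeriv Q U
  have hle2 : ∫⁻ f, ENNReal.ofReal (Real.exp (h f - llr Q U f)) ∂Q ≤ ENNReal.ofReal C := by
    calc _ ≤ ∫⁻ f, G f * (Q.rnDeriv U f)⁻¹ ∂Q := by
          refine lintegral_mono_ae ?_
          filter_upwards [hle, Measure.rnDeriv_pos hac, hac.ae_le (Measure.rnDeriv_lt_top Q U)]
            with f h1 h2 h3
          have hpos : 0 < (Q.rnDeriv U f).toReal := ENNReal.toReal_pos h2.ne' h3.ne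
          rw [llr, Real.exp_sub, Real.exp_log hpos, div_eq_mul_inv,
            ENNReal.ofReal_mul (by positivity), ENNReal.ofReal_inv_of_pos hpos,
            ENNReal.ofReal_toReal h3.ne]
          gcongr
      _ = ∫⁻ f, Q.rnDeriv U f * (G f * (Q.rnDeriv U f)⁻¹) ∂U := by
          exact (lintegral_rnDeriv_mul hac (hG.mul hρ.inv).aemeasurable).symm
      _ ≤ ∫⁻ f, G f ∂U := by
          refine lintegral_mono fun f => ?_
          rw [mul_left_comm]
          exact mul_le_of_le_one_right' (ENNReal.mul_inv_le_one _)
      _ ≤ _ := hGC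
  have h3 := (ENNReal.ofReal_le_ofReal_iff hC.le).mp (hJ.trans hle2)
  have h4 := (Real.le_log_iff_exp_le hC).mpr h3
  linarith

/-- A power of two `σ` below `2 h` that balances `v² σ` against `u² h / (2 σ)`. -/
lemma exists_dyadic_balance {u v h : ℝ} (hv : 0 ≤ v) (hvu : v ≤ u) (hh : 1 ≤ h) :
    ∃ k : ℕ, (2 : ℝ) ^ k ≤ 2 * h ∧
      v ^ 2 * 2 ^ k + u ^ 2 * h / (2 * 2 ^ k) ≤ u ^ 2 / 2 + 2 * u * v * √h := by
  have hu : 0 ≤ u := hv.trans hvu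
  have hh0 : 0 < h := by linarith
  have hsq : √h * √h = h := Real.mul_self_sqrt hh0.le
  have hs1 : 1 ≤ √h := by rw [Real.one_le_sqrt]; exact hh
  by_cases hcase : v * √h ≤ u
  · obtain ⟨k, hk1, hk2⟩ := exists_nat_pow_near (x := 2 * h) (y := 2) (by linarith) (by norm_num)
    refine ⟨k, hk1, ?_⟩
    rw [pow_succ] at hk2
    have hk0 : (0 : ℝ) < 2 ^ k := by positivity
    have h1 : v ^ 2 * 2 ^ k ≤ v ^ 2 * (2 * h) := by gcongr
    have h2 : v ^ 2 * (2 * h) ≤ 2 * u * v * √h := by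
      have : v ^ 2 * (2 * h) = 2 * (v * √h) * (v * √h) := by
        calc _ = v ^ 2 * (2 * (√h * √h)) := by rw [hsq]
          _ = _ := by ring
      rw [this]
      have : 0 ≤ v * √h := by positivity
      nlinarith
    have h3 : u ^ 2 * h / (2 * 2 ^ k) ≤ u ^ 2 / 2 := by
      rw [div_le_div_iff₀ (by positivity) (by norm_num)]
      nlinarith [sq_nonneg u]
    linarith
  · push Not at hcase
    have hv0 : 0 < v := by
      rcases hv.eq_or_lt with h0 | h0
      · rw [← h0] at hcase; linarith
      · exact h0
    have hX : 1 ≤ √h * u / v := by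
      rw [le_div_iff₀ hv0]; nlinarith
    obtain ⟨k, hk1, hk2⟩ := exists_nat_pow_near (x := √h * u / v) (y := 2) hX (by norm_num)
    have hk0 : (0 : ℝ) < 2 ^ k := by positivity
    rw [pow_succ, div_lt_iff₀ hv0] at hk2
    rw [le_div_iff₀ hv0] at hk1
    refine ⟨k, ?_, ?_⟩
    · have : 2 ^ k * v ≤ h * v := by nlinarith
      nlinarith [le_of_mul_le_mul_right this hv0]
    · -- with `p = v √h`, `q = u` and `2 ^ k = c √h u / v`, `1/2 ≤ c ≤ 1`, the sum is
      -- `p q (c + 1 / (2 c)) ≤ 3 p q / 2`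
      have hu0 : 0 < u := hv0.trans_le hvu
      have h4 : v ^ 2 * 2 ^ k + u ^ 2 * h / (2 * 2 ^ k) ≤ 3 / 2 * (u * v * √h) := by
        rw [← sub_nonneg]
        have : 3 / 2 * (u * v * √h) - (v ^ 2 * 2 ^ k + u ^ 2 * h / (2 * 2 ^ k))
            = (√h * u - 2 ^ k * v) * (2 * (2 ^ k * v) - √h * u) / (2 * 2 ^ k) := by
          field_simp
          nlinarith [hsq]
        rw [this]
        refine div_nonneg (mul_nonneg (by linarith) (by linarith)) (by positivity)
      have : 0 ≤ u * v * √h := by positivity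
      nlinarith [sq_nonneg u]

lemma le_cConst_exp {n : ℕ} (hn : 0 < n) :
    (Nat.clog 2 n : ℝ) ≤ Real.exp 1 + (Real.log (2 * (n : ℝ) ^ 2)) ^ 2 := by
  have hn' : (0 : ℝ) < n := by exact_mod_cast hn
  have hx : 0 ≤ Real.log n := Real.log_natCast_nonneg n
  have h2 := Real.log_two_gt_d9
  have he := Real.exp_one_gt_d9
  have hlog : Real.log (2 * (n : ℝ) ^ 2) = Real.log 2 + 2 * Real.log n := by
    rw [Real.log_mul (by norm_num) (by positivity), Real.log_pow]; norm_num
  have hK : ((Nat.clog 2 n : ℝ) - 1) * Real.log 2 ≤ Real.log n := by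
    rcases Nat.eq_zero_or_pos (Nat.clog 2 n) with h0 | h0
    · rw [h0]; push_cast; linarith
    · have h3 : 2 ^ (Nat.clog 2 n - 1) < n := by
        rw [← Nat.lt_clog_iff_pow_lt (by norm_num)]
        omega
      have h4 : ((2 : ℝ) ^ (Nat.clog 2 n - 1)) ≤ n := by exact_mod_cast h3.le
      have h5 := Real.log_le_log (by positivity) h4
      rw [Real.log_pow, Nat.cast_sub h0] at h5
      simpa using h5
  rw [hlog]
  nlinarith

lemma one_le_cConst (n : ℕ) : 1 ≤ cConst n := by
  rw [cConst, Real.le_log_iff_exp_le (by positivity)]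
  nlinarith [sq_nonneg (Real.log (2 * (n : ℝ) ^ 2))]

lemma ofReal_rpow_half (x : ℝ) : (ENNReal.ofReal x) ^ (1 / 2 : ℝ) = ENNReal.ofReal (√x) := by
  rcases le_total 0 x with hx | hx
  · rw [ENNReal.ofReal_rpow_of_nonneg hx (by norm_num), Real.sqrt_eq_rpow]
  · rw [ENNReal.ofReal_of_nonpos hx, Real.sqrt_eq_zero_of_nonpos hx]
    simp

/-- The quadratic-in-`lam` family of bounds produced by the Gaussian mixtures implies the
deviation bound with the velocities `√v2` and `√w2`. -/
lemma abs_le_of_forall_quadratic {n : ℕ} (hn : 0 < n) {a v2 w2 h L : ℝ} (hL : 0 < L) (hv2 : 0 ≤ v2)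
    (hw2 : 0 ≤ w2) (hvw : v2 ≤ L ^ 2 * w2) (hh : 1 ≤ h) (hhn : h < n / 2)
    (hq : ∀ k < Nat.clog 2 n, ∀ lam : ℝ, lam * n * a - lam ^ 2 * n * v2 - 2 ^ k
      - lam ^ 2 * n * L ^ 2 * w2 / (2 * 2 ^ k) ≤ h) :
    |a| ≤ 2 * √v2 * √(h / n) + 2 * L * √w2 / √n := by
  have hn' : (0 : ℝ) < n := by exact_mod_cast hn
  have hvu : √v2 ≤ L * √w2 := by
    rw [← Real.sqrt_sq hL.le, ← Real.sqrt_mul (sq_nonneg L)]; exact Real.sqrt_le_sqrt hvw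
  obtain ⟨k, hk1, hk2⟩ := exists_dyadic_balance (Real.sqrt_nonneg v2) hvu hh
  have hk : k < Nat.clog 2 n := by
    rw [Nat.lt_clog_iff_pow_lt (by norm_num)]
    have : (2 : ℝ) ^ k < n := by linarith
    exact_mod_cast this
  have hk0 : (0 : ℝ) < 2 ^ k := by positivity
  set u := L * √w2 with hu
  set v := √v2 with hv
  have hv' : v ^ 2 = v2 := Real.sq_sqrt hv2
  have hu' : u ^ 2 = L ^ 2 * w2 := by rw [hu, mul_pow, Real.sq_sqrt hw2]
  set D := v2 + L ^ 2 * w2 / (2 * 2 ^ k) with hD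
  have hdisc : discrim (n * D) (-(n * a)) (h + 2 ^ k) ≤ 0 := by
    refine discrim_le_zero fun lam => ?_
    have := hq k hk lam
    have e : n * D * (lam * lam) = lam ^ 2 * n * v2 + lam ^ 2 * n * L ^ 2 * w2 / (2 * 2 ^ k) := by
      rw [hD]; ring
    rw [e]; linarith
  rw [discrim] at hdisc
  have h1 : n * a ^ 2 ≤ 4 * (D * (h + 2 ^ k)) := by
    refine le_of_mul_le_mul_left ?_ hn'
    nlinarith
  have h2 : D * (h + 2 ^ k) ≤ (v * √h + u) ^ 2 := by
    have hsq : √h ^ 2 = h := Real.sq_sqrt (by linarith)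
    have e : D * (h + 2 ^ k) = v ^ 2 * h + (v ^ 2 * 2 ^ k + u ^ 2 * h / (2 * 2 ^ k)) + u ^ 2 / 2 := by
      rw [hD, hv', hu']; field_simp; ring
    rw [e, add_sq, mul_pow v, hsq]
    linarith
  have h3 : (√n * |a|) ^ 2 ≤ (2 * (v * √h + u)) ^ 2 := by
    rw [mul_pow, Real.sq_sqrt hn'.le, sq_abs]; linarith
  have h4 := le_of_sq_le_sq h3 (by positivity)
  have hsn : 0 < √(n : ℝ) := Real.sqrt_pos.mpr hn'
  have e : 2 * v * √(h / n) + 2 * L * √w2 / √n = 2 * (v * √h + u) / √n := by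
    rw [Real.sqrt_div' _ hn'.le, hu]; ring
  rw [e, le_div_iff₀ hsn, mul_comm]
  exact h4

/-! ### Deviation bounds for vector fields -/

section Static

variable {H : Type u} [NormedAddCommGroup H] [InnerProductSpace ℝ H]
  {Z : Type v} {T : H → H →L[ℝ] H} {G : H → Z → H} {L : ℝ≥0} {e : ℕ → H}

lemma abs_inner_le_localNorm (hpos : ∀ f, (T f).IsPositive)
    (hGM : ∀ f z, inner ℝ (T f (G f z)) (G f z) ≤ (L : ℝ) ^ 2) {f v : H}
    (hv : localNorm (T f) v ≠ ⊤) (z : Z) :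
    |inner ℝ v (G f z)| ≤ L * (localNorm (T f) v).toReal := by
  obtain ⟨x, rfl⟩ := exists_of_localNorm_ne_top hv
  rw [localNorm_apply (hpos f), ENNReal.toReal_ofReal (Real.sqrt_nonneg _)]
  refine abs_le_of_sq_le_sq ?_ (by positivity)
  rw [mul_pow, Real.sq_sqrt ((hpos f).inner_nonneg_left x), mul_comm]
  exact (inner_sq_le_of_isPositive (hpos f) _ _).trans
    (mul_le_mul_of_nonneg_left (hGM f z) ((hpos f).inner_nonneg_left x))

variable [MeasurableSpace Z] {P : Measure Z}

/-- The second moment of `X` under `(P + P_S) / 2`. -/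
noncomputable def mixedSecondMoment (P : Measure Z) {n : ℕ} (S : Fin n → Z) (X : Z → ℝ) : ℝ :=
  (∫ z, X z ^ 2 ∂P + (∑ i, X (S i) ^ 2) / n) / 2

lemma lintegral_sq_eq_mixedSecondMoment {n : ℕ} (hn : 0 < n) (S : Fin n → Z) {X : Z → ℝ}
    (hX : Measurable X) (hX2 : Integrable (fun z => X z ^ 2) P) :
    ∫⁻ z, ENNReal.ofReal (X z ^ 2) ∂((2 : ℝ≥0∞)⁻¹ • (P + empMeasure S))
      = ENNReal.ofReal (mixedSecondMoment P S X) := by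
  have hn' : (0 : ℝ) < n := by exact_mod_cast hn
  have hm : Measurable fun z => ENNReal.ofReal (X z ^ 2) := by fun_prop
  rw [lintegral_smul_measure, lintegral_add_measure, empMeasure, lintegral_smul_measure,
    lintegral_finsetSum_measure]
  simp_rw [lintegral_dirac' _ hm]
  rw [← ofReal_integral_eq_lintegral_ofReal hX2 (ae_of_all _ fun _ => sq_nonneg _),
    ← ENNReal.ofReal_sum_of_nonneg fun _ _ => sq_nonneg _, mixedSecondMoment, smul_eq_mul,
    smul_eq_mul]
  have hi : 0 ≤ ∫ z, X z ^ 2 ∂P := integral_nonneg fun _ => sq_nonneg _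
  have hs : 0 ≤ ∑ i, X (S i) ^ 2 := Finset.sum_nonneg fun _ _ => sq_nonneg _
  rw [ENNReal.ofReal_div_of_pos two_pos, ENNReal.ofReal_add hi (by positivity),
    ENNReal.ofReal_div_of_pos hn', ENNReal.ofReal_natCast, ENNReal.ofReal_ofNat, ENNReal.div_eq_inv_mul,
    ENNReal.div_eq_inv_mul]

lemma empExponent_const_mul {n : ℕ} (hn : 0 < n) (S : Fin n → Z) {X : Z → ℝ}
    (hX : ∫ z, X z ∂P = 0) (lam : ℝ) :
    empExponent P S (fun z => lam * X z)
      = lam * n * ((∑ i, X (S i)) / n) - lam ^ 2 * n * mixedSecondMoment P S X := by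
  have hn' : (n : ℝ) ≠ 0 := by exact_mod_cast hn.ne'
  simp only [empExponent, mixedSecondMoment, mul_pow, integral_const_mul, hX,
    Finset.sum_sub_distrib, ← Finset.mul_sum, ← Finset.sum_div, Finset.sum_const, Finset.card_univ,
    Fintype.card_fin, nsmul_eq_mul]
  field_simp
  ring

variable [MeasurableSpace H]

/-- The samples for which the prior integrals of all limit mixtures, for the mixing variances
`2 ^ k / (n L²)` with `2 ^ k < n`, are at most their number divided by the confidence level `δ`. -/
def goodSamples (P : Measure Z) (e : ℕ → H) (T : H → H →L[ℝ] H) (G : H → Z → H) (L : ℝ≥0) (n : ℕ)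
    (δ : ℝ) (U : Measure H) : Set (Fin n → Z) :=
  {S | ∑ k ∈ Finset.range (Nat.clog 2 n),
    ∫⁻ f, limitMixture P e (2 ^ k / (n * (L : ℝ) ^ 2)) (T f) (G f) S ∂U
      ≤ ENNReal.ofReal (Nat.clog 2 n / δ)}

variable [BorelSpace H] [SecondCountableTopology H] [IsProbabilityMeasure P]

lemma measurable_limitMixture_left (hT : ∀ x, Measurable fun f => T f x)
    (hG : ∀ x, Measurable fun p : H × Z => inner ℝ x (G p.1 p.2)) {s : ℝ} {n : ℕ}
    (S : Fin n → Z) : Measurable fun f => limitMixture P e s (T f) (G f) S := by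
  have h := measurable_limitMixture (P := P) (e := e) (s := s) hT hG n
  have hS : Measurable fun f : H => (f, S) := measurable_id.prodMk measurable_const
  have h2 := h.comp hS
  simp only [Function.comp_def] at h2
  exact h2

lemma measurable_lintegral_limitMixture (hT : ∀ x, Measurable fun f => T f x)
    (hG : ∀ x, Measurable fun p : H × Z => inner ℝ x (G p.1 p.2)) (s : ℝ) (n : ℕ) (U : Measure H)
    [IsProbabilityMeasure U] :
    Measurable fun S : Fin n → Z => ∫⁻ f, limitMixture P e s (T f) (G f) S ∂U := by
  have h := (measurable_limitMixture (P := P) (e := e) (s := s) hT hG n).comp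
    (measurable_swap (α := Fin n → Z) (β := H))
  exact h.lintegral_prod_right'

lemma measurableSet_goodSamples (hT : ∀ x, Measurable fun f => T f x)
    (hG : ∀ x, Measurable fun p : H × Z => inner ℝ x (G p.1 p.2)) (n : ℕ) (δ : ℝ) (U : Measure H)
    [IsProbabilityMeasure U] : MeasurableSet (goodSamples P e T G L n δ U) :=
  measurableSet_le (Finset.measurable_sum _ fun _ _ =>
    measurable_lintegral_limitMixture hT hG _ n U) measurable_const

/-- Markov's inequality for the limit mixtures. -/
lemma le_measure_goodSamples (hT : ∀ x, Measurable fun f => T f x)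
    (hG : ∀ x, Measurable fun p : H × Z => inner ℝ x (G p.1 p.2)) (hpos : ∀ f, (T f).IsPositive)
    (hGM : ∀ f z, inner ℝ (T f (G f z)) (G f z) ≤ (L : ℝ) ^ 2) (n : ℕ) {δ : ℝ}
    (hδ : δ ∈ Ioo (0 : ℝ) 1) (U : Measure H) [IsProbabilityMeasure U] :
    ENNReal.ofReal (1 - δ) ≤ Measure.pi (fun _ : Fin n => P) (goodSamples P e T G L n δ U) := by
  set K := Nat.clog 2 n with hK
  set Φ : (Fin n → Z) → ℝ≥0∞ := fun S => ∑ k ∈ Finset.range K,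
    ∫⁻ f, limitMixture P e (2 ^ k / (n * (L : ℝ) ^ 2)) (T f) (G f) S ∂U with hΦ
  have hΦm : ∀ k, Measurable fun S : Fin n → Z =>
      ∫⁻ f, limitMixture P e (2 ^ k / (n * (L : ℝ) ^ 2)) (T f) (G f) S ∂U := fun k =>
    measurable_lintegral_limitMixture hT hG _ n U
  have hint : ∫⁻ S, Φ S ∂(Measure.pi fun _ : Fin n => P) ≤ K := by
    rw [hΦ, lintegral_finsetSum _ fun k _ => hΦm k]
    refine (Finset.sum_le_sum fun k _ => lintegral_limitMixture_le_one hT hG hpos (by positivity)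
      hGM n U).trans ?_
    simp
  have hms := measurableSet_goodSamples (P := P) (e := e) (L := L) hT hG n δ U
  have hcompl : Measure.pi (fun _ : Fin n => P) (goodSamples P e T G L n δ U)ᶜ
      ≤ ENNReal.ofReal δ := by
    rcases Nat.eq_zero_or_pos K with h0 | h0
    · have : (goodSamples P e T G L n δ U)ᶜ = ∅ := by
        rw [compl_empty_iff, eq_univ_iff_forall]
        intro S
        simp only [goodSamples, mem_ofPred_eq, ← hK, h0, Finset.range_zero, Finset.sum_empty]
        exact bot_le
      rw [this]; simp
    · have hK0 : (0 : ℝ) < K := by exact_mod_cast h0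
      have hr : 0 < (K : ℝ) / δ := div_pos hK0 hδ.1
      have hsub : (goodSamples P e T G L n δ U)ᶜ ⊆ {S | ENNReal.ofReal (K / δ) ≤ Φ S} := by
        intro S hS
        simp only [goodSamples, mem_compl_iff, mem_ofPred_eq, not_le] at hS
        exact hS.le
      refine (measure_mono hsub).trans ?_
      have h1 := (meas_ge_le_lintegral_div (μ := Measure.pi fun _ : Fin n => P) (f := Φ)
        (Finset.measurable_sum _ fun k _ => hΦm k).aemeasurable
        (ENNReal.ofReal_pos.mpr hr).ne' ENNReal.ofReal_ne_top)
      refine h1.trans ((ENNReal.div_le_div_right hint _).trans ?_)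
      rw [← ENNReal.ofReal_natCast, ← ENNReal.ofReal_div_of_pos hr]
      refine ENNReal.ofReal_le_ofReal ?_
      rw [div_div_eq_mul_div, mul_div_cancel_left₀ _ hK0.ne']
  have h1 := prob_compl_eq_one_sub (μ := Measure.pi fun _ : Fin n => P) hms.compl
  rw [compl_compl] at h1
  rw [h1, ENNReal.ofReal_sub _ hδ.1.le, ENNReal.ofReal_one]
  exact tsub_le_tsub_left hcompl 1

lemma abs_integral_le_of_sq_le {α : Type*} [MeasurableSpace α] {Q : Measure α}
    [IsProbabilityMeasure Q] {A B : α → ℝ} (hA : Integrable A Q) (hB : Integrable B Q)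
    (hAB : ∀ f, A f ^ 2 ≤ 2 * B f) : |∫ f, A f ∂Q| ≤ 2 * √(∫ f, B f ∂Q) * √(1 / 2) := by
  have hB0 : ∀ f, 0 ≤ B f := fun f => by nlinarith [hAB f, sq_nonneg (A f)]
  have hv0 : 0 ≤ ∫ f, B f ∂Q := integral_nonneg hB0
  set a := ∫ f, A f ∂Q with ha
  refine abs_le_of_sq_le_sq ?_ (by positivity)
  rw [mul_pow, mul_pow, Real.sq_sqrt hv0, Real.sq_sqrt (by norm_num)]
  have h6 : ∀ f, 2 * a * A f - a ^ 2 ≤ 2 * B f := fun f => by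
    nlinarith [hAB f, sq_nonneg (A f - a)]
  have h7 : Integrable (fun f => 2 * a * A f - a ^ 2) Q :=
    (hA.const_mul _).sub (integrable_const _)
  have h8 := integral_mono h7 (hB.const_mul 2) h6
  rw [integral_sub (hA.const_mul _) (integrable_const _), integral_const_mul, integral_const_mul,
    ← ha] at h8
  simp only [integral_const, probReal_univ, one_smul] at h8
  linarith

/-- The Donsker–Varadhan inequality applied to a limit mixture, with the mean shifted by `lam` times
a vector field along which the gradients are centered. -/
lemma quadratic_le_klDiv_add_log (hT : ∀ x, Measurable fun f => T f x)
    (hG : ∀ x, Measurable fun p : H × Z => inner ℝ x (G p.1 p.2)) (hpos : ∀ f, (T f).IsPositive)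
    (hGM : ∀ f z, inner ℝ (T f (G f z)) (G f z) ≤ (L : ℝ) ^ 2) (he : DenseRange e)
    {n : ℕ} (hn : 0 < n) {U : Measure H} [IsProbabilityMeasure U] {S : Fin n → Z} {s C : ℝ}
    (hs : 0 < s) (hC : 0 < C)
    (hmix : ∫⁻ f, limitMixture P e s (T f) (G f) S ∂U ≤ ENNReal.ofReal C)
    {Q : Measure H} [IsProbabilityMeasure Q] (hkl : InformationTheory.klDiv Q U ≠ ⊤) {μ : H → H}
    (hcent : ∀ᵐ f ∂Q, ∫ z, inner ℝ (μ f) (G f z) ∂P = 0)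
    (hfin : ∀ᵐ f ∂Q, localNorm (T f) (μ f) ≠ ⊤)
    (hN : Integrable (fun f => (localNorm (T f) (μ f)).toReal ^ 2) Q)
    (hA : Integrable (fun f => (∑ i, inner ℝ (μ f) (G f (S i))) / n) Q)
    (hB : Integrable (fun f => mixedSecondMoment P S fun z => inner ℝ (μ f) (G f z)) Q) (lam : ℝ) :
    lam * n * ∫ f, (∑ i, inner ℝ (μ f) (G f (S i))) / n ∂Q
        - lam ^ 2 * n * ∫ f, mixedSecondMoment P S (fun z => inner ℝ (μ f) (G f z)) ∂Q
        - n * s * L ^ 2 - lam ^ 2 / (2 * s) * ∫ f, (localNorm (T f) (μ f)).toReal ^ 2 ∂Q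
      ≤ (InformationTheory.klDiv Q U).toReal + Real.log C := by
  have i1 := (hA.const_mul (lam * n)).sub (hB.const_mul (lam ^ 2 * n))
  have i2 := i1.sub (integrable_const (n * s * (L : ℝ) ^ 2))
  have i3 := i2.sub (hN.const_mul (lam ^ 2 / (2 * s)))
  have hm : Measurable fun f => limitMixture P e s (T f) (G f) S :=
    measurable_limitMixture_left hT hG S
  have hdv := integral_le_klDiv_add_log hm i3 (by
      filter_upwards [hfin, hcent] with f hf hc
      obtain ⟨x, hx⟩ := exists_of_localNorm_ne_top hf
      have h1 := exp_le_limitMixture (P := P) (hpos f) he hs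
        (fun y => (hG y).comp measurable_prodMk_left) (hGM f) lam x S
      refine le_trans (ENNReal.ofReal_le_ofReal (Real.exp_le_exp.mpr (le_of_eq ?_))) h1
      have h2 : (localNorm (T f) (μ f)).toReal ^ 2 = inner ℝ (T f x) x := by
        rw [← hx, localNorm_apply (hpos f), ENNReal.toReal_ofReal (Real.sqrt_nonneg _),
          Real.sq_sqrt ((hpos f).inner_nonneg_left x)]
      rw [hx, empExponent_const_mul hn S hc lam]
      simp only [Pi.sub_apply]
      rw [h2, hx]
      ring) hC hmix hkl
  rwa [integral_sub' i2 (hN.const_mul _), integral_sub' i1 (integrable_const _),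
    integral_sub' (hA.const_mul _) (hB.const_mul _), integral_const, probReal_univ, one_smul,
    integral_const_mul, integral_const_mul, integral_const_mul] at hdv

variable [CompleteSpace H]

/-- **Deviation bound for vector fields.** On a good sample, for every law `Q` and every vector
field `μ` along which the gradients are centered, the averaged gradient is controlled by the
velocities of `μ` and the complexity of `Q`. -/
lemma abs_integral_le_increment (hT : ∀ x, Measurable fun f => T f x)
    (hG : ∀ x, Measurable fun p : H × Z => inner ℝ x (G p.1 p.2)) (hpos : ∀ f, (T f).IsPositive)
    (hGM : ∀ f z, inner ℝ (T f (G f z)) (G f z) ≤ (L : ℝ) ^ 2) (hL : 0 < L) (he : DenseRange e)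
    {n : ℕ} (hn : 0 < n) {δ : ℝ} (hδ : δ ∈ Ioo (0 : ℝ) 1) {U : Measure H} [IsProbabilityMeasure U]
    {S : Fin n → Z} (hS : S ∈ goodSamples P e T G L n δ U) {Q : Measure H} [IsProbabilityMeasure Q]
    {μ : H → H} (hμ : Measurable μ) (hcent : ∀ᵐ f ∂Q, ∫ z, inner ℝ (μ f) (G f z) ∂P = 0) :
    ENNReal.ofReal |∫ f, (∑ i, inner ℝ (μ f) (G f (S i))) / n ∂Q|
      ≤ 2 * (∫⁻ f, ∫⁻ z, ENNReal.ofReal (inner ℝ (μ f) (G f z) ^ 2)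
            ∂((2 : ℝ≥0∞)⁻¹ • (P + empMeasure S)) ∂Q) ^ (1 / 2 : ℝ)
          * ((complexity δ Q U + ENNReal.ofReal (cConst n)) / n) ^ (1 / 2 : ℝ)
        + 2 * L * (∫⁻ f, localNorm (T f) (μ f) ^ 2 ∂Q) ^ (1 / 2 : ℝ) / (n : ℝ≥0∞) ^ (1 / 2 : ℝ) := by
  have hn' : (0 : ℝ) < n := by exact_mod_cast hn
  have hnE : (n : ℝ≥0∞) ^ (1 / 2 : ℝ) = ENNReal.ofReal (√n) := by
    rw [← ENNReal.ofReal_natCast, ofReal_rpow_half]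
  have hsn : 0 < √(n : ℝ) := Real.sqrt_pos.mpr hn'
  have hNm : Measurable fun f => localNorm (T f) (μ f) := by
    have h := (measurable_localNorm hT hpos).comp (measurable_id.prodMk hμ)
    simp only [Function.comp_def, id_eq] at h
    exact h
  by_cases hW : ∫⁻ f, localNorm (T f) (μ f) ^ 2 ∂Q = ⊤
  · have : 2 * (L : ℝ≥0∞) * (∫⁻ f, localNorm (T f) (μ f) ^ 2 ∂Q) ^ (1 / 2 : ℝ)
        / (n : ℝ≥0∞) ^ (1 / 2 : ℝ) = ⊤ := by
      rw [hW, ENNReal.top_rpow_of_pos (by norm_num), ENNReal.mul_top (by simp [hL.ne']),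
        ENNReal.top_div_of_ne_top (by rw [hnE]; exact ENNReal.ofReal_ne_top)]
    rw [this, add_top]
    exact le_top
  set N : H → ℝ := fun f => (localNorm (T f) (μ f)).toReal with hN
  have hNmeas : Measurable N := hNm.ennreal_toReal
  have hfin : ∀ᵐ f ∂Q, localNorm (T f) (μ f) ≠ ⊤ := by
    filter_upwards [ae_lt_top (hNm.pow_const 2) hW] with f hf
    intro h
    simp [h] at hf
  have hN2 : ∀ᵐ f ∂Q, localNorm (T f) (μ f) ^ 2 = ENNReal.ofReal (N f ^ 2) := by
    filter_upwards [hfin] with f hf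
    rw [hN, ← ENNReal.toReal_pow, ENNReal.ofReal_toReal (by simpa using hf)]
  have hN2i : Integrable (fun f => N f ^ 2) Q := by
    refine ⟨(hNmeas.pow_const 2).aestronglyMeasurable, ?_⟩
    rw [hasFiniteIntegral_iff_ofReal (ae_of_all _ fun _ => sq_nonneg _), ← lintegral_congr_ae hN2]
    exact lt_top_iff_ne_top.mpr hW
  have hWeq : ∫⁻ f, localNorm (T f) (μ f) ^ 2 ∂Q = ENNReal.ofReal (∫ f, N f ^ 2 ∂Q) := by
    rw [lintegral_congr_ae hN2,
      ofReal_integral_eq_lintegral_ofReal hN2i (ae_of_all _ fun _ => sq_nonneg _)]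
  have hXm : Measurable fun p : H × Z => inner ℝ (μ p.1) (G p.1 p.2) := measurable_inner_of_weak hG hμ
  have hXm1 : ∀ f, Measurable fun z => inner ℝ (μ f) (G f z) := fun f =>
    hXm.comp measurable_prodMk_left
  have hXm2 : ∀ z, Measurable fun f => inner ℝ (μ f) (G f z) := fun z =>
    hXm.comp measurable_prodMk_right
  have hXb : ∀ᵐ f ∂Q, ∀ z, |inner ℝ (μ f) (G f z)| ≤ L * N f := by
    filter_upwards [hfin] with f hf z using abs_inner_le_localNorm hpos hGM hf z
  have hXb2 : ∀ᵐ f ∂Q, ∀ z, inner ℝ (μ f) (G f z) ^ 2 ≤ (L : ℝ) ^ 2 * N f ^ 2 := by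
    filter_upwards [hXb] with f hf z
    rw [← sq_abs, ← mul_pow]
    exact pow_le_pow_left₀ (abs_nonneg _) (hf z) 2
  have hX2i : ∀ᵐ f ∂Q, Integrable (fun z => inner ℝ (μ f) (G f z) ^ 2) P := by
    filter_upwards [hXb2] with f hf
    exact Integrable.mono' (integrable_const ((L : ℝ) ^ 2 * N f ^ 2))
      ((hXm1 f).pow_const 2).aestronglyMeasurable
      (ae_of_all _ fun z => by rw [Real.norm_of_nonneg (sq_nonneg _)]; exact hf z)
  set A : H → ℝ := fun f => (∑ i, inner ℝ (μ f) (G f (S i))) / n with hA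
  set B : H → ℝ := fun f => mixedSecondMoment P S fun z => inner ℝ (μ f) (G f z) with hB
  have hAm : Measurable A := (Finset.measurable_sum _ fun i _ => hXm2 (S i)).div_const _
  have hBm : Measurable B :=
    (((hXm.pow_const 2).stronglyMeasurable.integral_prod_right' (ν := P)).measurable.add
      ((Finset.measurable_sum _ fun i _ => (hXm2 (S i)).pow_const 2).div_const _)).div_const _
  have hB0 : ∀ f, 0 ≤ B f := fun f => by
    simp only [hB, mixedSecondMoment]
    have h1 : 0 ≤ ∫ z, inner ℝ (μ f) (G f z) ^ 2 ∂P := integral_nonneg fun _ => sq_nonneg _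
    have h2 : 0 ≤ ∑ i, inner ℝ (μ f) (G f (S i)) ^ 2 := Finset.sum_nonneg fun _ _ => sq_nonneg _
    positivity
  have hBb : ∀ᵐ f ∂Q, B f ≤ (L : ℝ) ^ 2 * N f ^ 2 := by
    filter_upwards [hXb2, hX2i] with f hf hfi
    have h1 : ∫ z, inner ℝ (μ f) (G f z) ^ 2 ∂P ≤ (L : ℝ) ^ 2 * N f ^ 2 :=
      (integral_mono hfi (integrable_const _) hf).trans (by simp)
    have h2 : (∑ i, inner ℝ (μ f) (G f (S i)) ^ 2) / n ≤ (L : ℝ) ^ 2 * N f ^ 2 := by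
      rw [div_le_iff₀ hn']
      refine (Finset.sum_le_sum fun i _ => hf (S i)).trans ?_
      simp [mul_comm]
    simp only [hB, mixedSecondMoment]
    linarith
  have hBi : Integrable B Q := Integrable.mono' (hN2i.const_mul ((L : ℝ) ^ 2))
    hBm.aestronglyMeasurable (by
      filter_upwards [hBb] with f hf
      rw [Real.norm_of_nonneg (hB0 f)]; exact hf)
  -- Cauchy–Schwarz over the sample
  have hA2 : ∀ f, A f ^ 2 ≤ 2 * B f := fun f => by
    have h1 : 0 ≤ ∫ z, inner ℝ (μ f) (G f z) ^ 2 ∂P := integral_nonneg fun _ => sq_nonneg _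
    have h2 := sq_sum_le_card_mul_sum_sq (s := Finset.univ)
      (f := fun i => inner ℝ (μ f) (G f (S i)))
    rw [Finset.card_univ, Fintype.card_fin] at h2
    have h3 : A f ^ 2 ≤ (∑ i, inner ℝ (μ f) (G f (S i)) ^ 2) / n := by
      simp only [hA, div_pow]
      rw [div_le_div_iff₀ (by positivity) hn']
      nlinarith
    simp only [hB, mixedSecondMoment]
    linarith
  have hAi : Integrable A Q := by
    refine Integrable.mono' ((integrable_const (1 : ℝ)).add (hBi.const_mul 2))
      hAm.aestronglyMeasurable (ae_of_all _ fun f => ?_)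
    have := hA2 f
    simp only [Real.norm_eq_abs, Pi.add_apply]
    nlinarith [sq_abs (A f), sq_nonneg (|A f| - 1)]
  have hVeq : ∫⁻ f, ∫⁻ z, ENNReal.ofReal (inner ℝ (μ f) (G f z) ^ 2)
      ∂((2 : ℝ≥0∞)⁻¹ • (P + empMeasure S)) ∂Q = ENNReal.ofReal (∫ f, B f ∂Q) := by
    rw [ofReal_integral_eq_lintegral_ofReal hBi (ae_of_all _ hB0)]
    refine lintegral_congr_ae ?_
    filter_upwards [hX2i] with f hf
    exact lintegral_sq_eq_mixedSecondMoment hn S (hXm1 f) hf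
  rw [hVeq, hWeq, ofReal_rpow_half, ofReal_rpow_half, hnE]
  set a := ∫ f, A f ∂Q with ha
  have hv0 : 0 ≤ ∫ f, B f ∂Q := integral_nonneg hB0
  by_cases hbig : ENNReal.ofReal (1 / 2) ≤ (complexity δ Q U + ENNReal.ofReal (cConst n)) / n
  · -- for large complexities the Cauchy–Schwarz inequality suffices
    refine le_trans ?_ le_self_add
    have h1 : |a| ≤ 2 * √(∫ f, B f ∂Q) * √(1 / 2) := abs_integral_le_of_sq_le hAi hBi hA2
    refine (ENNReal.ofReal_le_ofReal h1).trans ?_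
    rw [ENNReal.ofReal_mul (by positivity), ENNReal.ofReal_mul (by norm_num), ENNReal.ofReal_ofNat]
    gcongr
    rw [← ofReal_rpow_half]
    exact ENNReal.rpow_le_rpow hbig (by norm_num)
  · push Not at hbig
    have hnE0 : (n : ℝ≥0∞) ≠ 0 := by exact_mod_cast hn.ne'
    have hfinite : complexity δ Q U + ENNReal.ofReal (cConst n) ≠ ⊤ := by
      intro h
      rw [h, ENNReal.top_div_of_ne_top (by simp)] at hbig
      exact absurd hbig (by simp)
    have hkl : InformationTheory.klDiv Q U ≠ ⊤ := by
      intro h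
      exact hfinite (by simp [complexity, h])
    set kl := (InformationTheory.klDiv Q U).toReal with hkl_def
    have hlogδ : 0 ≤ Real.log (1 / δ) := Real.log_nonneg (by
      rw [le_div_iff₀ hδ.1]; linarith [hδ.2])
    have hc1 := one_le_cConst n
    set h := kl + Real.log (1 / δ) + cConst n with hh
    have hkl0 : 0 ≤ kl := ENNReal.toReal_nonneg
    have hcomp : complexity δ Q U + ENNReal.ofReal (cConst n) = ENNReal.ofReal h := by
      rw [complexity, ← ENNReal.ofReal_toReal hkl, ← ENNReal.ofReal_add hkl0 hlogδ,
        ← ENNReal.ofReal_add (by linarith) (by linarith)]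
    rw [hcomp, ← ENNReal.ofReal_natCast n, ← ENNReal.ofReal_div_of_pos hn'] at hbig ⊢
    have hhn : h < n / 2 := by
      have := (ENNReal.ofReal_lt_ofReal_iff (by norm_num)).mp hbig
      rw [div_lt_div_iff₀ hn' two_pos] at this
      linarith
    rw [ofReal_rpow_half]
    have hvw : ∫ f, B f ∂Q ≤ (L : ℝ) ^ 2 * ∫ f, N f ^ 2 ∂Q := by
      rw [← integral_const_mul]; exact integral_mono_ae hBi (hN2i.const_mul _) hBb
    have hw0 : 0 ≤ ∫ f, N f ^ 2 ∂Q := integral_nonneg fun _ => sq_nonneg _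
    have main := abs_le_of_forall_quadratic (a := a) hn (NNReal.coe_pos.mpr hL) hv0 hw0 hvw
      (by linarith : 1 ≤ h) hhn (fun k hk lam => by
        set s : ℝ := 2 ^ k / (n * (L : ℝ) ^ 2) with hs_def
        have hL' : (0 : ℝ) < L := NNReal.coe_pos.mpr hL
        have hs : 0 < s := by positivity
        have hK : (0 : ℝ) < Nat.clog 2 n := by exact_mod_cast (Nat.zero_le k).trans_lt hk
        have hC : 0 < (Nat.clog 2 n : ℝ) / δ := div_pos hK hδ.1
        have hmix : ∫⁻ f, limitMixture P e s (T f) (G f) S ∂U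
            ≤ ENNReal.ofReal (Nat.clog 2 n / δ) := by
          refine le_trans ?_ hS
          exact Finset.single_le_sum (f := fun k => ∫⁻ f, limitMixture P e
            (2 ^ k / (n * (L : ℝ) ^ 2)) (T f) (G f) S ∂U) (fun _ _ => bot_le)
            (Finset.mem_range.mpr hk)
        have hdv := quadratic_le_klDiv_add_log hT hG hpos hGM he hn hs hC hmix hkl hcent hfin hN2i
          hAi hBi lam
        have h3 : (n : ℝ) * s * (L : ℝ) ^ 2 = 2 ^ k := by
          rw [hs_def]; field_simp
        rw [h3] at hdv
        have hlogK : Real.log (Nat.clog 2 n / δ) ≤ Real.log (1 / δ) + cConst n := by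
          rw [div_eq_mul_one_div, Real.log_mul hK.ne' (one_div_pos.mpr hδ.1).ne', add_comm]
          gcongr
          rw [cConst]
          exact Real.log_le_log hK (le_cConst_exp hn)
        have e1 : lam ^ 2 * n * (L : ℝ) ^ 2 * (∫ f, N f ^ 2 ∂Q) / (2 * 2 ^ k)
            = lam ^ 2 / (2 * s) * ∫ f, N f ^ 2 ∂Q := by
          rw [hs_def]; field_simp
        rw [e1]
        linarith)
    refine (ENNReal.ofReal_le_ofReal main).trans (le_of_eq ?_)
    rw [ENNReal.ofReal_add (by positivity) (by positivity), ENNReal.ofReal_mul (by positivity),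
      ENNReal.ofReal_mul (by norm_num), ENNReal.ofReal_div_of_pos hsn,
      ENNReal.ofReal_mul (by positivity), ENNReal.ofReal_mul (by norm_num), ENNReal.ofReal_ofNat,
      ENNReal.ofReal_coe_nnreal]

end Static

/-! ### The deviation function and its gradients -/

section Setting

variable {H : Type u} {Z : Type v} [MeasurableSpace Z] {P : Measure Z} {ℓ : H → Z → ℝ} {F : Set H}

lemma integral_deviation [IsProbabilityMeasure P] {f : H} (hf : Integrable (ℓ f) P) :
    ∫ z, deviation P ℓ f z ∂P = 0 := by
  simp only [deviation]
  rw [integral_sub (integrable_const _) hf]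
  simp [risk]

lemma integrable_deviation [IsProbabilityMeasure P] {f : H} (hf : Integrable (ℓ f) P) :
    Integrable (deviation P ℓ f) P :=
  (integrable_const _).sub hf

lemma empDeviation_eq {n : ℕ} (hn : 0 < n) (S : Fin n → Z) (f : H) :
    empDeviation P ℓ S f = risk P ℓ f - empRisk ℓ S f := by
  have hn' : (n : ℝ) ≠ 0 := by exact_mod_cast hn.ne'
  simp only [empDeviation, deviation, empRisk, Finset.sum_sub_distrib, Finset.sum_const,
    Finset.card_univ, Fintype.card_fin, nsmul_eq_mul]
  field_simp

section Measurable

variable [MeasurableSpace H] [SFinite P]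

lemma measurable_risk (hℓ_meas : Measurable (Function.uncurry ℓ)) : Measurable (risk P ℓ) :=
  (hℓ_meas.stronglyMeasurable.integral_prod_right' (ν := P)).measurable

lemma measurable_deviation (hℓ_meas : Measurable (Function.uncurry ℓ)) :
    Measurable fun p : H × Z => deviation P ℓ p.1 p.2 :=
  ((measurable_risk hℓ_meas).comp measurable_fst).sub hℓ_meas

lemma measurable_deviation_left (hℓ_meas : Measurable (Function.uncurry ℓ)) (z : Z) :
    Measurable fun f : H => deviation P ℓ f z :=
  (measurable_risk hℓ_meas).sub (hℓ_meas.comp measurable_prodMk_right)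

end Measurable

variable [NormedAddCommGroup H] [InnerProductSpace ℝ H] {Sig : H → H →L[ℝ] H}

open Classical in
/-- The inverse metric, extended by `0` outside `F`, so that it is positive everywhere. -/
noncomputable def extSig (F : Set H) (Sig : H → H →L[ℝ] H) (f : H) : H →L[ℝ] H :=
  if f ∈ F then Sig f else 0

open Classical in
/-- The gradient of the deviation function, extended by `0` outside `F`. -/
noncomputable def extGrad [CompleteSpace H] (P : Measure Z) (ℓ : H → Z → ℝ) (F : Set H) (f : H)
    (z : Z) : H :=
  if f ∈ F then gradient (fun g => deviation P ℓ g z) f else 0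

lemma extSig_of_mem {f : H} (hf : f ∈ F) : extSig F Sig f = Sig f := if_pos hf

lemma extSig_isPositive (hSig_pos : ∀ f ∈ F, (Sig f).IsPositive) (f : H) :
    (extSig F Sig f).IsPositive := by
  unfold extSig
  split_ifs with h
  · exact hSig_pos f h
  · exact ContinuousLinearMap.isPositive_zero

lemma differentiableAt_deviation (hF : IsOpen F)
    (hℓ_diff : ∀ z : Z, DifferentiableOn ℝ (fun f => ℓ f z) F)
    (hr_diff : DifferentiableOn ℝ (risk P ℓ) F) {f : H} (hf : f ∈ F) (z : Z) :
    DifferentiableAt ℝ (fun g => deviation P ℓ g z) f :=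
  ((hr_diff f hf).differentiableAt (hF.mem_nhds hf)).sub
    ((hℓ_diff z f hf).differentiableAt (hF.mem_nhds hf))

section Measurable

variable [MeasurableSpace H] [BorelSpace H]

lemma measurable_extSig (hF : IsOpen F) (hSig_meas : ∀ x : H, Measurable fun f => Sig f x) (x : H) :
    Measurable fun f => extSig F Sig f x := by
  classical
  have h : (fun f => extSig F Sig f x) = fun f => if f ∈ F then Sig f x else 0 := by
    funext f
    unfold extSig
    split_ifs <;> simp
  rw [h]
  exact Measurable.ite hF.measurableSet (hSig_meas x) measurable_const

variable [SFinite P]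

variable [CompleteSpace H]

/-- Weak measurability of the gradients: directional derivatives are limits of difference
quotients. -/
lemma measurable_inner_extGrad (hF : IsOpen F) (hℓ_meas : Measurable (Function.uncurry ℓ))
    (hℓ_diff : ∀ z : Z, DifferentiableOn ℝ (fun f => ℓ f z) F)
    (hr_diff : DifferentiableOn ℝ (risk P ℓ) F) (x : H) :
    Measurable fun p : H × Z => inner ℝ x (extGrad P ℓ F p.1 p.2) := by
  classical
  have hΔ := measurable_deviation (P := P) hℓ_meas
  refine measurable_of_tendsto_metrizable (f := fun (N : ℕ) (p : H × Z) => if p.1 ∈ F then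
    ((N : ℝ) + 1) * (deviation P ℓ (p.1 + ((N : ℝ) + 1)⁻¹ • x) p.2 - deviation P ℓ p.1 p.2) else 0)
    (fun N => ?_) ?_
  · refine Measurable.ite (measurable_fst hF.measurableSet) ?_ measurable_const
    have h1 : Measurable fun p : H × Z => (p.1 + ((N : ℝ) + 1)⁻¹ • x, p.2) :=
      ((measurable_add_const _).comp measurable_fst).prodMk measurable_snd
    exact ((hΔ.comp h1).sub hΔ).const_mul _
  · rw [tendsto_pi_nhds]
    rintro ⟨f, z⟩
    by_cases hf : f ∈ F
    · have hd := (differentiableAt_deviation (P := P) hF hℓ_diff hr_diff hf z).hasGradientAt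
      have h2 := hd.hasFDerivAt.lim x (c := fun N : ℕ => ((N : ℝ) + 1)) (l := atTop)
        (tendsto_norm_atTop_atTop.comp
          (tendsto_atTop_add_const_right _ _ tendsto_natCast_atTop_atTop))
      simp only [hf, if_true, extGrad, InnerProductSpace.toDual_apply_apply, smul_eq_mul] at h2 ⊢
      rw [real_inner_comm]
      exact h2
    · simp [hf, extGrad]

end Measurable

variable [CompleteSpace H]

/-- The Lipschitz condition bounds the derivative of the deviation in the directions of finite
local norm. -/
lemma abs_inner_gradient_le (hF : IsOpen F)
    (hℓ_diff : ∀ z : Z, DifferentiableOn ℝ (fun f => ℓ f z) F)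
    (hr_diff : DifferentiableOn ℝ (risk P ℓ) F) (hSig_pos : ∀ f ∈ F, (Sig f).IsPositive)
    {L : ℝ≥0} (hLip : LipschitzDeviation P ℓ F Sig L) {f : H} (hf : f ∈ F) (z : Z) (x : H) :
    |inner ℝ (Sig f x) (gradient (fun g => deviation P ℓ g z) f)|
      ≤ L * √(inner ℝ (Sig f x) x) := by
  have hpos := hSig_pos f hf
  set ν := √(inner ℝ (Sig f x) x) with hν
  rcases (Real.sqrt_nonneg (inner ℝ (Sig f x) x)).eq_or_lt with h0 | h0
  · have hz : inner ℝ (Sig f x) x = 0 :=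
      (Real.sqrt_eq_zero (hpos.inner_nonneg_left x)).mp h0.symm
    rw [apply_eq_zero_of_inner_self_eq_zero hpos hz]
    simp; positivity
  rw [← hν] at h0
  have hd := (differentiableAt_deviation (P := P) hF hℓ_diff hr_diff hf z).hasGradientAt
  set D := inner ℝ (Sig f x) (gradient (fun g => deviation P ℓ g z) f) with hD
  set γ : ℝ → H := fun ρ => f + (ρ / ν) • Sig f x with hγ
  have hγd : HasDerivAt γ (ν⁻¹ • Sig f x) 0 := by
    have h1 : HasDerivAt (fun ρ : ℝ => ρ / ν) (ν⁻¹) 0 := by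
      simpa using (hasDerivAt_id (0 : ℝ)).div_const ν
    exact (h1.smul_const (Sig f x)).const_add f
  have hγ0 : γ 0 = f := by simp [hγ]
  have hcomp : HasDerivAt (fun ρ => deviation P ℓ (γ ρ) z) (D / ν) 0 := by
    have h1 : HasFDerivAt (fun g => deviation P ℓ g z)
        (InnerProductSpace.toDual ℝ H (gradient (fun g => deviation P ℓ g z) f)) (γ 0) := by
      rw [hγ0]; exact hd.hasFDerivAt
    have h2 := h1.comp_hasDerivAt (0 : ℝ) hγd
    refine h2.congr_deriv ?_
    rw [map_smul, InnerProductSpace.toDual_apply_apply, real_inner_comm, smul_eq_mul, hD]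
    ring
  have hslope := hcomp.tendsto_slope_zero_right
  have hlim : Tendsto (fun ρ : ℝ => ‖deviation P ℓ (γ ρ) z - deviation P ℓ f z‖ₑ / ENNReal.ofReal ρ)
      (𝓝[>] 0) (𝓝 ‖D / ν‖ₑ) := by
    refine (hslope.enorm).congr' ?_
    filter_upwards [self_mem_nhdsWithin] with ρ hρ
    rw [mem_Ioi] at hρ
    rw [zero_add, hγ0, smul_eq_mul, enorm_mul, ENNReal.div_eq_inv_mul, enorm_inv hρ.ne',
      Real.enorm_of_nonneg hρ.le]
  have hγF : ∀ᶠ ρ in 𝓝[>] (0 : ℝ), γ ρ ∈ F := by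
    have : Tendsto γ (𝓝 0) (𝓝 f) := by
      have := hγd.continuousAt.tendsto
      rwa [hγ0] at this
    exact nhdsWithin_le_nhds (this (hF.mem_nhds hf))
  have hle : ‖D / ν‖ₑ ≤ L := by
    refine le_trans ?_ (hLip f hf z)
    rw [← hlim.limsup_eq]
    refine limsup_le_limsup ?_
    filter_upwards [hγF, self_mem_nhdsWithin] with ρ hρF hρ
    rw [mem_Ioi] at hρ
    gcongr
    refine le_iSup₂_of_le (γ ρ) hρF (le_iSup_of_le ?_ le_rfl)
    have : γ ρ - f = Sig f ((ρ / ν) • x) := by simp [hγ]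
    rw [this, localNorm_apply hpos]
    refine ENNReal.ofReal_le_ofReal (le_of_eq ?_)
    rw [map_smul, real_inner_smul_left, real_inner_smul_right, ← mul_assoc,
      Real.sqrt_mul (mul_self_nonneg _), ← hν, Real.sqrt_mul_self (by positivity)]
    field_simp
  have h3 : |D / ν| ≤ L := by
    rw [← Real.norm_eq_abs, ← coe_nnnorm]
    exact_mod_cast hle
  rwa [abs_div, abs_of_pos h0, div_le_iff₀ h0] at h3

lemma inner_extSig_extGrad_le (hF : IsOpen F)
    (hℓ_diff : ∀ z : Z, DifferentiableOn ℝ (fun f => ℓ f z) F)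
    (hr_diff : DifferentiableOn ℝ (risk P ℓ) F) (hSig_pos : ∀ f ∈ F, (Sig f).IsPositive)
    {L : ℝ≥0} (hLip : LipschitzDeviation P ℓ F Sig L) (f : H) (z : Z) :
    inner ℝ (extSig F Sig f (extGrad P ℓ F f z)) (extGrad P ℓ F f z) ≤ (L : ℝ) ^ 2 := by
  by_cases hf : f ∈ F
  · simp only [extSig, extGrad, hf, if_true]
    set g := gradient (fun g => deviation P ℓ g z) f
    have h := abs_inner_gradient_le hF hℓ_diff hr_diff hSig_pos hLip hf z g
    have h0 := (hSig_pos f hf).inner_nonneg_left g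
    rw [abs_of_nonneg h0] at h
    have h1 := Real.sq_sqrt h0
    nlinarith [Real.sqrt_nonneg (inner ℝ (Sig f g) g), L.coe_nonneg]
  · simp [extSig, extGrad, hf]

end Setting

/-! ### Disintegration of velocities -/

section Disintegration

variable {H : Type u} [NormedAddCommGroup H] [InnerProductSpace ℝ H] {Z : Type v}
  {T : H → H →L[ℝ] H} {G : H → Z → H} {L : ℝ≥0}

lemma enorm_inner_le_localNorm (hpos : ∀ f, (T f).IsPositive)
    (hGM : ∀ f z, inner ℝ (T f (G f z)) (G f z) ≤ (L : ℝ) ^ 2) (hL : 0 < L) (f v : H) (z : Z) :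
    ‖inner ℝ v (G f z)‖ₑ ≤ L * localNorm (T f) v := by
  by_cases hv : localNorm (T f) v = ⊤
  · rw [hv, ENNReal.mul_top (by simp [hL.ne'])]; exact le_top
  · have h := abs_inner_le_localNorm hpos hGM hv z
    rw [Real.enorm_eq_ofReal_abs, ← ENNReal.ofReal_toReal hv, ← ENNReal.ofReal_coe_nnreal,
      ← ENNReal.ofReal_mul L.coe_nonneg]
    exact ENNReal.ofReal_le_ofReal h

variable [MeasurableSpace Z] {P : Measure Z} [IsProbabilityMeasure P] [CompleteSpace H]
  [MeasurableSpace H] [BorelSpace H] [SecondCountableTopology H]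

/-- The mean of a kernel inherits the centering of the gradients, and replaces the kernel in their
expectation. -/
lemma integral_inner_kernel_mean (hT : ∀ x, Measurable fun f => T f x)
    (hG : ∀ x, Measurable fun p : H × Z => inner ℝ x (G p.1 p.2)) (hpos : ∀ f, (T f).IsPositive)
    (hGM : ∀ f z, inner ℝ (T f (G f z)) (G f z) ≤ (L : ℝ) ^ 2) (hL : 0 < L)
    (ρ : Measure H) [IsProbabilityMeasure ρ] (κ : Kernel H H) [IsMarkovKernel κ]
    (hfin : ∫⁻ p, localNorm (T p.1) p.2 ∂(ρ ⊗ₘ κ) ≠ ⊤)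
    (hcent : ∀ᵐ p ∂(ρ ⊗ₘ κ), ∫ z, inner ℝ p.2 (G p.1 z) ∂P = 0) :
    (∀ᵐ f ∂ρ, ∫ z, inner ℝ (∫ x, x ∂(κ f)) (G f z) ∂P = 0) ∧
      ∀ z, Integrable (fun f => inner ℝ (∫ x, x ∂(κ f)) (G f z)) ρ ∧
        ∫ p, inner ℝ p.2 (G p.1 z) ∂(ρ ⊗ₘ κ) = ∫ f, inner ℝ (∫ x, x ∂(κ f)) (G f z) ∂ρ := by
  have hN : Measurable fun p : H × H => localNorm (T p.1) p.2 := measurable_localNorm hT hpos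
  have hφ : Measurable fun q : (H × H) × Z => inner ℝ q.1.2 (G q.1.1 q.2) :=
    measurable_inner_of_weak (G := fun p : H × H => G p.1) (u := fun p : H × H => p.2)
      (fun x => (hG x).comp ((measurable_fst.comp measurable_fst).prodMk measurable_snd))
      measurable_snd
  have hfin1 : ∀ᵐ f ∂ρ, ∫⁻ x, localNorm (T f) x ∂(κ f) < ⊤ := by
    rw [Measure.lintegral_compProd hN] at hfin
    exact ae_lt_top hN.lintegral_kernel_prod_right' hfin
  have hid : ∀ f, ∫⁻ x, localNorm (T f) x ∂(κ f) < ⊤ → Integrable (fun x => x) (κ f) := by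
    intro f hf
    refine ⟨measurable_id.aestronglyMeasurable, ?_⟩
    calc ∫⁻ x, ‖x‖ₑ ∂(κ f) ≤ ∫⁻ x, ENNReal.ofReal (√‖T f‖ + 1) * localNorm (T f) x ∂(κ f) := by
          refine lintegral_mono fun x => ?_
          rw [← ofReal_norm]
          exact norm_le_localNorm (hpos f) x
      _ = ENNReal.ofReal (√‖T f‖ + 1) * ∫⁻ x, localNorm (T f) x ∂(κ f) :=
          lintegral_const_mul' _ _ ENNReal.ofReal_ne_top
      _ < ⊤ := ENNReal.mul_lt_top ENNReal.ofReal_lt_top hf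
  have hinner : ∀ f, ∫⁻ x, localNorm (T f) x ∂(κ f) < ⊤ → ∀ z,
      ∫ x, inner ℝ x (G f z) ∂(κ f) = inner ℝ (∫ x, x ∂(κ f)) (G f z) := by
    intro f hf z
    have h := integral_inner (𝕜 := ℝ) (hid f hf) (G f z)
    simp_rw [fun x => real_inner_comm (G f z) x]
    exact h
  refine ⟨?_, fun z => ?_⟩
  · filter_upwards [hfin1, Measure.ae_ae_of_ae_compProd hcent] with f hf hc
    have hφf : Measurable fun q : Z × H => inner ℝ q.2 (G f q.1) :=
      hφ.comp ((measurable_const.prodMk measurable_snd).prodMk measurable_fst)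
    have hint : Integrable (fun q : Z × H => inner ℝ q.2 (G f q.1)) (P.prod (κ f)) := by
      refine ⟨hφf.aestronglyMeasurable, ?_⟩
      refine lt_of_le_of_lt (lintegral_mono fun q => enorm_inner_le_localNorm hpos hGM hL f q.2 q.1) ?_
      rw [lintegral_const_mul' _ _ ENNReal.coe_ne_top]
      refine ENNReal.mul_lt_top ENNReal.coe_lt_top ?_
      have hNf : Measurable fun q : Z × H => localNorm (T f) q.2 := by
        have hp : Measurable fun q : Z × H => (f, q.2) := measurable_const.prodMk measurable_snd
        have h := hN.comp hp
        simp only [Function.comp_def] at h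
        exact h
      rw [lintegral_prod _ hNf.aemeasurable]
      simpa using hf
    calc ∫ z, inner ℝ (∫ x, x ∂(κ f)) (G f z) ∂P
        = ∫ z, ∫ x, inner ℝ x (G f z) ∂(κ f) ∂P :=
          integral_congr_ae (ae_of_all _ fun z => (hinner f hf z).symm)
      _ = ∫ x, ∫ z, inner ℝ x (G f z) ∂P ∂(κ f) :=
          integral_integral_swap (f := fun z x => inner ℝ x (G f z)) hint
      _ = 0 := by
          rw [integral_congr_ae hc]; simp
  · have hm : Measurable fun p : H × H => inner ℝ p.2 (G p.1 z) :=
      hφ.comp (measurable_id.prodMk measurable_const)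
    have hint : Integrable (fun p : H × H => inner ℝ p.2 (G p.1 z)) (ρ ⊗ₘ κ) := by
      refine ⟨hm.aestronglyMeasurable, ?_⟩
      refine lt_of_le_of_lt (lintegral_mono fun p => enorm_inner_le_localNorm hpos hGM hL p.1 p.2 z) ?_
      rw [lintegral_const_mul' _ _ ENNReal.coe_ne_top]
      exact ENNReal.mul_lt_top ENNReal.coe_lt_top (lt_top_iff_ne_top.mpr hfin)
    have hae : ∀ᵐ f ∂ρ, ∫ x, inner ℝ x (G f z) ∂(κ f) = inner ℝ (∫ x, x ∂(κ f)) (G f z) := by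
      filter_upwards [hfin1] with f hf using hinner f hf z
    refine ⟨hint.integral_compProd.congr hae, ?_⟩
    rw [Measure.integral_compProd hint]
    exact integral_congr_ae hae

end Disintegration

/-! ### Deviations along random paths -/

/-- A family of random variables with almost surely continuous paths agrees, outside a null set
that does not depend on the time, with a jointly measurable one. -/
lemma exists_measurable_version {H : Type*} [NormedAddCommGroup H] [MeasurableSpace H]
    [BorelSpace H] {Ω : Type*} [MeasurableSpace Ω] {m : Measure Ω}
    {sol : ℝ → Ω → H} (hae : ∀ t, 0 ≤ t → AEMeasurable (sol t) m)
    (hc : ∀ᵐ p ∂m, ContinuousOn (fun t => sol t p) (Ici 0)) :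
    ∃ Y : ℝ → Ω → H, Measurable (fun q : ℝ × Ω => Y q.1 q.2) ∧ (∀ p, Continuous fun t => Y t p) ∧
      ∀ᵐ p ∂m, ∀ t, 0 ≤ t → sol t p = Y t p := by
  classical
  set d : ℕ → ℝ := TopologicalSpace.denseSeq ℝ with hd
  have hd0 : ∀ j, 0 ≤ max (d j) 0 := fun j => le_max_right _ _
  set M : ℕ → Ω → H := fun j => (hae _ (hd0 j)).mk _ with hM
  have hgood : ∀ᵐ p ∂m, (∀ j, sol (max (d j) 0) p = M j p) ∧
      ContinuousOn (fun t => sol t p) (Ici 0) := by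
    filter_upwards [ae_all_iff.mpr fun j => (hae _ (hd0 j)).ae_eq_mk, hc] with p h1 h2 using ⟨h1, h2⟩
  obtain ⟨B, hBsub, hBm, hB0⟩ := exists_measurable_superset_of_null (ae_iff.mp hgood)
  have hB : ∀ p, p ∉ B → (∀ j, sol (max (d j) 0) p = M j p) ∧
      ContinuousOn (fun t => sol t p) (Ici 0) := fun p hp => by
    by_contra h
    exact hp (hBsub h)
  set Y : ℝ → Ω → H := fun t p => if p ∈ B then 0 else sol (max t 0) p with hY
  have hcont : ∀ p, Continuous fun t => Y t p := by
    intro p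
    by_cases hp : p ∈ B
    · simp only [hY, hp, if_true]; exact continuous_const
    · simp only [hY, hp, if_false]
      exact (hB p hp).2.comp_continuous (by fun_prop) fun t => mem_Ici.mpr (le_max_right _ _)
  have hYd : ∀ j, Measurable (Y (d j)) := fun j => by
    have : Y (d j) = fun p => if p ∈ B then 0 else M j p := by
      funext p
      by_cases hp : p ∈ B
      · simp [hY, hp]
      · simp [hY, hp, (hB p hp).1 j]
    rw [this]
    exact Measurable.ite hBm measurable_const (hae _ (hd0 j)).measurable_mk
  have hYm : ∀ t, Measurable (Y t) := fun t => by
    have ht := mem_closure_iff_seq_limit.mp ((TopologicalSpace.denseRange_denseSeq ℝ) t)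
    obtain ⟨x, hx, hxt⟩ := ht
    refine measurable_of_tendsto_metrizable (f := fun i p => Y (x i) p) (fun i => ?_)
      (tendsto_pi_nhds.mpr fun p => ((hcont p).tendsto t).comp hxt)
    obtain ⟨j, hj⟩ := hx i
    rw [← hj]
    exact hYd j
  refine ⟨Y, measurable_uncurry_of_continuous_of_measurable hcont hYm, hcont, ?_⟩
  filter_upwards [measure_eq_zero_iff_ae_notMem.mp hB0] with p hp t ht
  simp [hY, hp, max_eq_left ht]

/-- A function all of whose integrals over initial intervals vanish is zero almost everywhere, by
Lebesgue differentiation. -/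
lemma ae_eq_zero_of_primitive_eq_zero {g : ℝ → ℝ} (hg : IntegrableOn g (Icc 0 1))
    (h : ∀ τ ∈ Icc (0 : ℝ) 1, ∫ t in (0 : ℝ)..τ, g t = 0) :
    ∀ᵐ t ∂(volume.restrict (Icc (0 : ℝ) 1)), g t = 0 := by
  have hi : IntervalIntegrable g volume 0 1 :=
    (intervalIntegrable_iff_integrableOn_Icc_of_le zero_le_one).mpr hg
  have h1 := hi.ae_hasDerivAt_integral
  rw [← restrict_Ioo_eq_restrict_Icc, ae_restrict_iff' measurableSet_Ioo]
  filter_upwards [h1] with t ht ht01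
  have h2 := ht (by rw [uIcc_of_le zero_le_one]; exact Ioo_subset_Icc_self ht01) 0 (by simp)
  have h3 : (fun τ => ∫ t in (0 : ℝ)..τ, g t) =ᶠ[𝓝 t] fun _ => 0 := by
    filter_upwards [Ioo_mem_nhds ht01.1 ht01.2] with τ hτ using h τ (Ioo_subset_Icc_self hτ)
  exact (h2.congr_of_eventuallyEq h3.symm).unique (hasDerivAt_const t (0 : ℝ))

section Paths

variable {H : Type u} [NormedAddCommGroup H] [InnerProductSpace ℝ H] [CompleteSpace H]
  [SecondCountableTopology H] [MeasurableSpace H] [BorelSpace H]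
  {Z : Type v} [MeasurableSpace Z] {P : Measure Z} [IsProbabilityMeasure P]
  {F : Set H} {ℓ : H → Z → ℝ} {Sig : H → H →L[ℝ] H} {L : ℝ≥0}
  {Ω : Type w} [MeasurableSpace Ω] {m : Measure Ω} [IsProbabilityMeasure m]
  {Y v : ℝ → Ω → H}

/-- The fundamental theorem of calculus for the deviation along a path with countably many
kinks. -/
lemma integral_inner_extGrad_eq_sub (hF : IsOpen F)
    (hℓ_diff : ∀ z : Z, DifferentiableOn ℝ (fun f => ℓ f z) F)
    (hr_diff : DifferentiableOn ℝ (risk P ℓ) F) {y w : ℝ → H} (hy : Continuous y)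
    (hyF : ∀ t, 0 ≤ t → y t ∈ F) {C : Set ℝ} (hC : C.Countable)
    (hode : ∀ t, 0 ≤ t → t ∉ C → HasDerivWithinAt y (w t) (Ici 0) t) (z : Z)
    (hi : IntegrableOn (fun t => inner ℝ (w t) (extGrad P ℓ F (y t) z)) (Icc 0 1))
    {τ : ℝ} (hτ : τ ∈ Icc (0 : ℝ) 1) :
    ∫ t in (0 : ℝ)..τ, inner ℝ (w t) (extGrad P ℓ F (y t) z)
      = deviation P ℓ (y τ) z - deviation P ℓ (y 0) z := by
  refine integral_eq_of_hasDerivAt_off_countable_of_le (fun t => deviation P ℓ (y t) z) _ hτ.1 hC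
    ?_ ?_ ?_
  · intro t ht
    have h := (differentiableAt_deviation (P := P) hF hℓ_diff hr_diff (hyF t ht.1) z).continuousAt
    exact (ContinuousAt.comp (f := y) h hy.continuousAt).continuousWithinAt
  · rintro t ⟨ht, htC⟩
    have h1 := (differentiableAt_deviation (P := P) hF hℓ_diff hr_diff (hyF t ht.1.le)
      z).hasGradientAt.hasFDerivAt
    have h2 := (hode t ht.1.le htC).hasDerivAt (Ici_mem_nhds ht.1)
    refine (h1.comp_hasDerivAt t h2).congr_deriv ?_
    rw [InnerProductSpace.toDual_apply_apply, extGrad, if_pos (hyF t ht.1.le), real_inner_comm]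
  · rw [intervalIntegrable_iff_integrableOn_Icc_of_le hτ.1]
    exact hi.mono_set (Icc_subset_Icc_right hτ.2)

lemma measurable_inner_extGrad_path (hF : IsOpen F) (hℓ_meas : Measurable (Function.uncurry ℓ))
    (hℓ_diff : ∀ z : Z, DifferentiableOn ℝ (fun f => ℓ f z) F)
    (hr_diff : DifferentiableOn ℝ (risk P ℓ) F)
    (hY : Measurable fun q : ℝ × Ω => Y q.1 q.2) (hv : Measurable fun q : ℝ × Ω => v q.1 q.2) :
    Measurable fun r : (ℝ × Ω) × Z => inner ℝ (v r.1.1 r.1.2) (extGrad P ℓ F (Y r.1.1 r.1.2) r.2) :=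
  measurable_inner_of_weak (G := fun q : ℝ × Ω => extGrad P ℓ F (Y q.1 q.2))
    (fun x => (measurable_inner_extGrad (P := P) hF hℓ_meas hℓ_diff hr_diff x).comp
      ((hY.comp measurable_fst).prodMk measurable_snd)) hv

lemma measurable_localNorm_path (hF : IsOpen F) (hSig_meas : ∀ x : H, Measurable (fun f => Sig f x))
    (hSig_pos : ∀ f ∈ F, (Sig f).IsPositive)
    (hY : Measurable fun q : ℝ × Ω => Y q.1 q.2) (hv : Measurable fun q : ℝ × Ω => v q.1 q.2) :
    Measurable fun q : ℝ × Ω => localNorm (extSig F Sig (Y q.1 q.2)) (v q.1 q.2) := by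
  have h := (measurable_localNorm (measurable_extSig hF hSig_meas)
    (extSig_isPositive hSig_pos)).comp (hY.prodMk hv)
  simp only [Function.comp_def] at h
  exact h

/-- Almost surely, all deviations satisfy the fundamental theorem of calculus along the path, which
has finite length. -/
lemma ae_path_integral_eq (hF : IsOpen F) (hℓ_meas : Measurable (Function.uncurry ℓ))
    (hℓ_diff : ∀ z : Z, DifferentiableOn ℝ (fun f => ℓ f z) F)
    (hr_diff : DifferentiableOn ℝ (risk P ℓ) F)
    (hSig_meas : ∀ x : H, Measurable (fun f => Sig f x))
    (hSig_pos : ∀ f ∈ F, (Sig f).IsPositive) (hL : 0 < L) (hLip : LipschitzDeviation P ℓ F Sig L)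
    (hY : Measurable fun q : ℝ × Ω => Y q.1 q.2) (hYc : ∀ p, Continuous fun t => Y t p)
    (hv : Measurable fun q : ℝ × Ω => v q.1 q.2)
    (hode : ∀ᵐ p ∂m, (∀ t, 0 ≤ t → Y t p ∈ F) ∧ ∃ C : Set ℝ, C.Countable ∧ ∀ t, 0 ≤ t → t ∉ C →
      HasDerivWithinAt (fun s => Y s p) (v t p) (Ici 0) t)
    (hfin : ∫⁻ t in Icc (0 : ℝ) 1, ∫⁻ p, localNorm (extSig F Sig (Y t p)) (v t p) ∂m ≠ ⊤) :
    ∀ᵐ p ∂m, ∫⁻ t in Icc (0 : ℝ) 1, localNorm (extSig F Sig (Y t p)) (v t p) < ⊤ ∧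
      ∀ z, ∀ τ ∈ Icc (0 : ℝ) 1, ∫ t in (0 : ℝ)..τ, inner ℝ (v t p) (extGrad P ℓ F (Y t p) z)
        = deviation P ℓ (Y τ p) z - deviation P ℓ (Y 0 p) z := by
  have hN := measurable_localNorm_path hF hSig_meas hSig_pos hY hv
  have hφ := measurable_inner_extGrad_path (P := P) hF hℓ_meas hℓ_diff hr_diff hY hv
  have hlen : ∀ᵐ p ∂m, ∫⁻ t in Icc (0 : ℝ) 1, localNorm (extSig F Sig (Y t p)) (v t p) < ⊤ := by
    rw [lintegral_lintegral_swap hN.aemeasurable] at hfin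
    exact ae_lt_top hN.lintegral_prod_left' hfin
  filter_upwards [hlen, hode] with p hp ⟨hpF, C, hC, hd⟩
  refine ⟨hp, fun z τ hτ => ?_⟩
  refine integral_inner_extGrad_eq_sub hF hℓ_diff hr_diff (hYc p) hpF hC hd z ⟨?_, ?_⟩ hτ
  · have h : Measurable fun t => inner ℝ (v t p) (extGrad P ℓ F (Y t p) z) :=
      hφ.comp ((measurable_id.prodMk (measurable_const (a := p))).prodMk (measurable_const (a := z)))
    exact h.aestronglyMeasurable
  · refine lt_of_le_of_lt (lintegral_mono fun t => enorm_inner_le_localNorm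
      (extSig_isPositive hSig_pos)
      (inner_extSig_extGrad_le hF hℓ_diff hr_diff hSig_pos hLip) hL _ _ z) ?_
    rw [lintegral_const_mul' _ _ ENNReal.coe_ne_top]
    exact ENNReal.mul_lt_top ENNReal.coe_lt_top hp

/-- The deviation has mean zero under `P` everywhere on `F`, hence so has its derivative along
almost every path at almost every time. -/
lemma ae_ae_integral_inner_extGrad_eq_zero (hF : IsOpen F)
    (hℓ_meas : Measurable (Function.uncurry ℓ)) (hℓ_int : ∀ f ∈ F, Integrable (ℓ f) P)
    (hℓ_diff : ∀ z : Z, DifferentiableOn ℝ (fun f => ℓ f z) F)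
    (hr_diff : DifferentiableOn ℝ (risk P ℓ) F)
    (hSig_meas : ∀ x : H, Measurable (fun f => Sig f x))
    (hSig_pos : ∀ f ∈ F, (Sig f).IsPositive) (hL : 0 < L) (hLip : LipschitzDeviation P ℓ F Sig L)
    (hY : Measurable fun q : ℝ × Ω => Y q.1 q.2) (hYc : ∀ p, Continuous fun t => Y t p)
    (hv : Measurable fun q : ℝ × Ω => v q.1 q.2)
    (hode : ∀ᵐ p ∂m, (∀ t, 0 ≤ t → Y t p ∈ F) ∧ ∃ C : Set ℝ, C.Countable ∧ ∀ t, 0 ≤ t → t ∉ C →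
      HasDerivWithinAt (fun s => Y s p) (v t p) (Ici 0) t)
    (hfin : ∫⁻ t in Icc (0 : ℝ) 1, ∫⁻ p, localNorm (extSig F Sig (Y t p)) (v t p) ∂m ≠ ⊤) :
    ∀ᵐ t ∂(volume.restrict (Icc (0 : ℝ) 1)), ∀ᵐ p ∂m,
      ∫ z, inner ℝ (v t p) (extGrad P ℓ F (Y t p) z) ∂P = 0 := by
  have hN := measurable_localNorm_path hF hSig_meas hSig_pos hY hv
  have hφ := measurable_inner_extGrad_path (P := P) hF hℓ_meas hℓ_diff hr_diff hY hv
  have hθ : Measurable fun q : ℝ × Ω => ∫ z, inner ℝ (v q.1 q.2) (extGrad P ℓ F (Y q.1 q.2) z) ∂P :=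
    (hφ.stronglyMeasurable.integral_prod_right' (ν := P)).measurable
  have hms : MeasurableSet {q : ℝ × Ω | ∫ z, inner ℝ (v q.1 q.2) (extGrad P ℓ F (Y q.1 q.2) z) ∂P = 0} :=
    hθ (measurableSet_singleton 0)
  rw [Measure.ae_ae_comm hms]
  filter_upwards [ae_path_integral_eq hF hℓ_meas hℓ_diff hr_diff hSig_meas hSig_pos hL hLip hY hYc hv
    hode hfin, hode] with p ⟨hp, hftc⟩ ⟨hpF, _⟩
  have hφp : Measurable fun q : ℝ × Z => inner ℝ (v q.1 p) (extGrad P ℓ F (Y q.1 p) q.2) :=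
    hφ.comp ((measurable_fst.prodMk (measurable_const (a := p))).prodMk measurable_snd)
  have hNp : Measurable fun t => localNorm (extSig F Sig (Y t p)) (v t p) := by
    have h := hN.comp (measurable_id.prodMk (measurable_const (a := p)))
    simp only [Function.comp_def, id_eq] at h
    exact h
  have hint : Integrable (fun q : ℝ × Z => inner ℝ (v q.1 p) (extGrad P ℓ F (Y q.1 p) q.2))
      ((volume.restrict (Icc (0 : ℝ) 1)).prod P) := by
    refine ⟨hφp.aestronglyMeasurable, ?_⟩
    refine lt_of_le_of_lt (lintegral_mono fun q => enorm_inner_le_localNorm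
      (extSig_isPositive hSig_pos)
      (inner_extSig_extGrad_le hF hℓ_diff hr_diff hSig_pos hLip) hL _ _ q.2) ?_
    rw [lintegral_const_mul' _ _ ENNReal.coe_ne_top]
    refine ENNReal.mul_lt_top ENNReal.coe_lt_top ?_
    have hNf : Measurable fun q : ℝ × Z => localNorm (extSig F Sig (Y q.1 p)) (v q.1 p) := by
      have h0 : Measurable fun q : ℝ × Z => q.1 := measurable_fst
      have h := hNp.comp h0
      simp only [Function.comp_def] at h
      exact h
    rw [lintegral_prod _ hNf.aemeasurable]
    simpa using hp
  refine ae_eq_zero_of_primitive_eq_zero hint.integral_prod_left fun τ hτ => ?_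
  have hint' : Integrable (fun q : ℝ × Z => inner ℝ (v q.1 p) (extGrad P ℓ F (Y q.1 p) q.2))
      ((volume.restrict (Ioc (0 : ℝ) τ)).prod P) :=
    hint.mono_measure (Measure.prod_mono
      (Measure.restrict_mono (Ioc_subset_Icc_self.trans (Icc_subset_Icc_right hτ.2)) le_rfl) le_rfl)
  rw [intervalIntegral.integral_of_le hτ.1,
    integral_integral_swap (f := fun t z => inner ℝ (v t p) (extGrad P ℓ F (Y t p) z)) hint']
  have h1 : ∀ z, ∫ t in Ioc 0 τ, inner ℝ (v t p) (extGrad P ℓ F (Y t p) z)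
      = deviation P ℓ (Y τ p) z - deviation P ℓ (Y 0 p) z := fun z => by
    rw [← intervalIntegral.integral_of_le hτ.1, hftc z τ hτ]
  simp_rw [h1]
  have hi1 := hℓ_int _ (hpF τ hτ.1)
  have hi0 := hℓ_int _ (hpF 0 le_rfl)
  rw [integral_sub (integrable_deviation hi1) (integrable_deviation hi0), integral_deviation hi1,
    integral_deviation hi0, sub_zero]

/-- The expected change of the deviation over the unit time interval is the time integral of the
expected derivatives. -/
lemma integral_deviation_sub_eq (hF : IsOpen F) (hℓ_meas : Measurable (Function.uncurry ℓ))
    (hℓ_diff : ∀ z : Z, DifferentiableOn ℝ (fun f => ℓ f z) F)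
    (hr_diff : DifferentiableOn ℝ (risk P ℓ) F)
    (hSig_meas : ∀ x : H, Measurable (fun f => Sig f x))
    (hSig_pos : ∀ f ∈ F, (Sig f).IsPositive) (hL : 0 < L) (hLip : LipschitzDeviation P ℓ F Sig L)
    (hY : Measurable fun q : ℝ × Ω => Y q.1 q.2) (hYc : ∀ p, Continuous fun t => Y t p)
    (hv : Measurable fun q : ℝ × Ω => v q.1 q.2)
    (hode : ∀ᵐ p ∂m, (∀ t, 0 ≤ t → Y t p ∈ F) ∧ ∃ C : Set ℝ, C.Countable ∧ ∀ t, 0 ≤ t → t ∉ C →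
      HasDerivWithinAt (fun s => Y s p) (v t p) (Ici 0) t)
    (hfin : ∫⁻ t in Icc (0 : ℝ) 1, ∫⁻ p, localNorm (extSig F Sig (Y t p)) (v t p) ∂m ≠ ⊤) (z : Z) :
    Integrable (fun q : ℝ × Ω => inner ℝ (v q.1 q.2) (extGrad P ℓ F (Y q.1 q.2) z))
        ((volume.restrict (Icc (0 : ℝ) 1)).prod m) ∧
      Integrable (fun p => deviation P ℓ (Y 1 p) z - deviation P ℓ (Y 0 p) z) m ∧
      ∫ p, (deviation P ℓ (Y 1 p) z - deviation P ℓ (Y 0 p) z) ∂m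
        = ∫ t in Icc (0 : ℝ) 1, ∫ p, inner ℝ (v t p) (extGrad P ℓ F (Y t p) z) ∂m := by
  have hN := measurable_localNorm_path hF hSig_meas hSig_pos hY hv
  have hφ := measurable_inner_extGrad_path (P := P) hF hℓ_meas hℓ_diff hr_diff hY hv
  have hφz : Measurable fun q : ℝ × Ω => inner ℝ (v q.1 q.2) (extGrad P ℓ F (Y q.1 q.2) z) :=
    hφ.comp (measurable_id.prodMk (measurable_const (a := z)))
  have hint : Integrable (fun q : ℝ × Ω => inner ℝ (v q.1 q.2) (extGrad P ℓ F (Y q.1 q.2) z))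
      ((volume.restrict (Icc (0 : ℝ) 1)).prod m) := by
    refine ⟨hφz.aestronglyMeasurable, ?_⟩
    refine lt_of_le_of_lt (lintegral_mono fun q => enorm_inner_le_localNorm
      (extSig_isPositive hSig_pos)
      (inner_extSig_extGrad_le hF hℓ_diff hr_diff hSig_pos hLip) hL _ _ z) ?_
    rw [lintegral_const_mul' _ _ ENNReal.coe_ne_top]
    refine ENNReal.mul_lt_top ENNReal.coe_lt_top ?_
    rw [lintegral_prod _ hN.aemeasurable]
    exact lt_top_iff_ne_top.mpr hfin
  have hae : ∀ᵐ p ∂m, ∫ t in Icc (0 : ℝ) 1, inner ℝ (v t p) (extGrad P ℓ F (Y t p) z)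
      = deviation P ℓ (Y 1 p) z - deviation P ℓ (Y 0 p) z := by
    filter_upwards [ae_path_integral_eq hF hℓ_meas hℓ_diff hr_diff hSig_meas hSig_pos hL hLip hY hYc
      hv hode hfin] with p ⟨_, hftc⟩
    rw [← hftc z 1 (by simp), intervalIntegral.integral_of_le zero_le_one,
      integral_Icc_eq_integral_Ioc]
  refine ⟨hint, hint.integral_prod_right.congr hae, ?_⟩
  rw [← integral_congr_ae hae]
  exact (integral_integral_swap
    (f := fun t p => inner ℝ (v t p) (extGrad P ℓ F (Y t p) z)) hint).symm

end Paths

/-! ### Posterior flows -/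

section Transport

variable {H : Type u} [NormedAddCommGroup H] [InnerProductSpace ℝ H] [CompleteSpace H]
  [SecondCountableTopology H] [MeasurableSpace H] [BorelSpace H]
  {Z : Type v} [MeasurableSpace Z] {P : Measure Z} [IsProbabilityMeasure P]
  {F : Set H} {ℓ : H → Z → ℝ} {Sig : H → H →L[ℝ] H} {L : ℝ≥0}

/-- A posterior flow has a jointly measurable version with continuous paths, which satisfies its
conditions with `Sig` replaced by the extension of `Sig` by zero. -/
lemma PosteriorFlow.exists_version {Q : Measure H} [IsProbabilityMeasure Q]
    (X : PosteriorFlow.{u, w} F Sig Q) :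
    ∃ Y : ℝ → H × X.Ω → H, Measurable (fun q : ℝ × (H × X.Ω) => Y q.1 q.2) ∧
      (∀ p, Continuous fun t => Y t p) ∧
      (∀ᵐ p ∂X.joint, ∀ t, 0 ≤ t → X.sol t p = Y t p) ∧
      (∀ᵐ p ∂X.joint, Y 0 p = p.1) ∧
      (∀ᵐ p ∂X.joint, (∀ t, 0 ≤ t → Y t p ∈ F) ∧ ∃ C : Set ℝ, C.Countable ∧
        ∀ t, 0 ≤ t → t ∉ C → HasDerivWithinAt (fun s => Y s p) (X.ξ t (Y t p) p.2) (Ici 0) t) ∧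
      ∫⁻ t in Icc (0 : ℝ) 1, ∫⁻ p, localNorm (extSig F Sig (Y t p)) (X.ξ t (Y t p) p.2) ∂X.joint
        ≠ ⊤ := by
  have hode : ∀ᵐ p ∂X.joint, ContinuousOn (fun t => X.sol t p) (Ici 0) ∧
    ∃ C : Set ℝ, C.Countable ∧ ∀ t, 0 ≤ t → t ∉ C →
      HasDerivWithinAt (fun s => X.sol s p) (X.ξ t (X.sol t p) p.2) (Ici 0) t := X.sol_ode
  have hmem : ∀ᵐ p ∂X.joint, ∀ t, 0 ≤ t → X.sol t p ∈ F := X.sol_mem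
  have hzero : ∀ᵐ p ∂X.joint, X.sol 0 p = p.1 := X.sol_zero
  obtain ⟨Y, hYm, hYc, hXY⟩ := exists_measurable_version (m := X.joint) X.aemeasurable_sol
    (hode.mono fun p hp => hp.1)
  refine ⟨Y, hYm, hYc, hXY, ?_, ?_, ?_⟩
  · filter_upwards [hXY, hzero] with p h1 h2
    rw [← h1 0 le_rfl, h2]
  · filter_upwards [hXY, hode, hmem] with p h1 h2 h3
    obtain ⟨_, C, hC, hd⟩ := h2
    refine ⟨fun t ht => h1 t ht ▸ h3 t ht, C, hC, fun t ht htC => ?_⟩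
    rw [← h1 t ht]
    exact (hd t ht htC).congr (fun s hs => (h1 s hs).symm) (h1 t ht).symm
  · have h := (X.length_lt_top 1 zero_le_one).ne
    convert h using 1
    refine setLIntegral_congr_fun measurableSet_Icc fun t ht => ?_
    refine lintegral_congr_ae ?_
    filter_upwards [hXY, hmem] with p h1 h2
    rw [← h1 t ht.1, extSig_of_mem (h2 t ht.1)]

/-- On a good sample, the increment bound controls the expected derivative of the sample-averaged
deviation along the flow: by disintegration only the mean flow contributes to this derivative. -/
lemma ae_abs_integral_le_incrementBound (hF : IsOpen F) (hℓ_meas : Measurable (Function.uncurry ℓ))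
    (hℓ_int : ∀ f ∈ F, Integrable (ℓ f) P)
    (hℓ_diff : ∀ z : Z, DifferentiableOn ℝ (fun f => ℓ f z) F)
    (hr_diff : DifferentiableOn ℝ (risk P ℓ) F)
    (hSig_meas : ∀ x : H, Measurable (fun f => Sig f x))
    (hSig_pos : ∀ f ∈ F, (Sig f).IsPositive) (hL : 0 < L) (hLip : LipschitzDeviation P ℓ F Sig L)
    {e : ℕ → H} (he : DenseRange e) {n : ℕ} (hn : 0 < n) {δ : ℝ} (hδ : δ ∈ Ioo (0 : ℝ) 1)
    {U : Measure H} [IsProbabilityMeasure U] {S : Fin n → Z}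
    (hS : S ∈ goodSamples P e (extSig F Sig) (extGrad P ℓ F) L n δ U)
    {Q : Measure H} [IsProbabilityMeasure Q] (X : PosteriorFlow.{u, w} F Sig Q)
    {Y : ℝ → H × X.Ω → H} (hY : Measurable fun q : ℝ × (H × X.Ω) => Y q.1 q.2)
    (hYc : ∀ p, Continuous fun t => Y t p)
    (hXY : ∀ᵐ p ∂X.joint, ∀ t, 0 ≤ t → X.sol t p = Y t p)
    (hode : ∀ᵐ p ∂X.joint, (∀ t, 0 ≤ t → Y t p ∈ F) ∧ ∃ C : Set ℝ, C.Countable ∧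
      ∀ t, 0 ≤ t → t ∉ C → HasDerivWithinAt (fun s => Y s p) (X.ξ t (Y t p) p.2) (Ici 0) t)
    (hfin : ∫⁻ t in Icc (0 : ℝ) 1, ∫⁻ p, localNorm (extSig F Sig (Y t p)) (X.ξ t (Y t p) p.2)
      ∂X.joint ≠ ⊤) :
    ∀ᵐ t ∂(volume.restrict (Icc (0 : ℝ) 1)),
      ENNReal.ofReal |(∑ i, ∫ p, inner ℝ (X.ξ t (Y t p) p.2) (extGrad P ℓ F (Y t p) (S i))
        ∂X.joint) / n| ≤ incrementBound P ℓ L S U δ X t := by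
  have hv : Measurable fun q : ℝ × (H × X.Ω) => X.ξ q.1 (Y q.1 q.2) q.2.2 :=
    X.measurable_ξ.comp (measurable_fst.prodMk (hY.prodMk (measurable_snd.comp measurable_snd)))
  have hT := measurable_extSig hF hSig_meas
  have hpos := extSig_isPositive hSig_pos
  have hG := measurable_inner_extGrad (P := P) hF hℓ_meas hℓ_diff hr_diff
  have hGM := inner_extSig_extGrad_le hF hℓ_diff hr_diff hSig_pos hLip
  have hN := measurable_localNorm_path (v := fun t p => X.ξ t (Y t p) p.2) hF hSig_meas hSig_pos hY hv
  have hfin1 : ∀ᵐ t ∂(volume.restrict (Icc (0 : ℝ) 1)),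
      ∫⁻ p, localNorm (extSig F Sig (Y t p)) (X.ξ t (Y t p) p.2) ∂X.joint < ⊤ :=
    ae_lt_top hN.lintegral_prod_right' hfin
  filter_upwards [hfin1, ae_ae_integral_inner_extGrad_eq_zero
    (v := fun t p => X.ξ t (Y t p) p.2) hF hℓ_meas hℓ_int hℓ_diff hr_diff
    hSig_meas hSig_pos hL hLip hY hYc hv hode hfin, ae_restrict_mem measurableSet_Icc]
    with t ht hct ht01
  have hYt : Measurable (Y t) := hY.comp (measurable_const.prodMk measurable_id)
  have hvt : Measurable fun p => X.ξ t (Y t p) p.2 :=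
    hv.comp (measurable_const.prodMk measurable_id)
  have hsol : X.sol t =ᵐ[X.joint] Y t := hXY.mono fun p hp => hp t ht01.1
  have hxi : (fun p => X.ξ t (X.sol t p) p.2) =ᵐ[X.joint] fun p => X.ξ t (Y t p) p.2 :=
    hsol.mono fun p hp => by simp only [hp]
  have hsolm : AEMeasurable (X.sol t) X.joint := hYt.aemeasurable.congr hsol.symm
  have hxim : AEMeasurable (fun p => X.ξ t (X.sol t p) p.2) X.joint :=
    hvt.aemeasurable.congr hxi.symm
  set κ := condDistrib (fun p : H × X.Ω => X.ξ t (X.sol t p) p.2) (X.sol t) X.joint with hκ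
  have : IsProbabilityMeasure (X.law t) := Measure.isProbabilityMeasure_map hsolm
  have hcomp : X.law t ⊗ₘ κ = X.joint.map fun p => (Y t p, X.ξ t (Y t p) p.2) := by
    rw [PosteriorFlow.law, hκ, compProd_map_condDistrib hxim]
    refine Measure.map_congr ?_
    filter_upwards [hsol] with p h1
    rw [h1]
  have hpair : Measurable fun p => (Y t p, X.ξ t (Y t p) p.2) := hYt.prodMk hvt
  have hNH : Measurable fun p : H × H => localNorm (extSig F Sig p.1) p.2 :=
    measurable_localNorm hT hpos
  have hφ : Measurable fun q : (H × H) × Z => inner ℝ q.1.2 (extGrad P ℓ F q.1.1 q.2) :=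
    measurable_inner_of_weak (G := fun p : H × H => extGrad P ℓ F p.1) (u := fun p : H × H => p.2)
      (fun x => (hG x).comp ((measurable_fst.comp measurable_fst).prodMk measurable_snd))
      measurable_snd
  have hθ : Measurable fun p : H × H => ∫ z, inner ℝ p.2 (extGrad P ℓ F p.1 z) ∂P :=
    (hφ.stronglyMeasurable.integral_prod_right' (ν := P)).measurable
  have hmean := integral_inner_kernel_mean (P := P) hT hG hpos hGM hL (X.law t) κ
    (by rw [hcomp, lintegral_map hNH hpair]; exact ht.ne)
    (by
      rw [hcomp]
      exact (ae_map_iff hpair.aemeasurable (hθ (measurableSet_singleton 0))).mpr hct)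
  have hμ : Measurable (X.mean t) := by
    have h : StronglyMeasurable fun f => ∫ x, x ∂(κ f) :=
      StronglyMeasurable.integral_kernel stronglyMeasurable_id
    exact h.measurable
  have hcent : ∀ᵐ f ∂X.law t, ∫ z, inner ℝ (X.mean t f) (extGrad P ℓ F f z) ∂P = 0 := hmean.1
  have hFt : ∀ᵐ f ∂X.law t, f ∈ F := by
    refine (ae_map_iff (p := (· ∈ F)) hsolm hF.measurableSet).mpr ?_
    filter_upwards [hsol, hode] with p h1 h2
    rw [h1]; exact h2.1 t ht01.1
  have hmain := abs_integral_le_increment hT hG hpos hGM hL he hn hδ hS hμ hcent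
  have hterm : ∀ z, ∫ p, inner ℝ (X.ξ t (Y t p) p.2) (extGrad P ℓ F (Y t p) z) ∂X.joint
      = ∫ f, inner ℝ (X.mean t f) (extGrad P ℓ F f z) ∂X.law t := fun z => by
    have hz : Measurable fun p : H × H => inner ℝ p.2 (extGrad P ℓ F p.1 z) :=
      hφ.comp (measurable_id.prodMk measurable_const)
    have h := (hmean.2 z).2
    rw [hcomp, integral_map hpair.aemeasurable hz.aestronglyMeasurable] at h
    exact h
  have hleft : ∫ f, (∑ i, inner ℝ (X.mean t f) (extGrad P ℓ F f (S i))) / n ∂X.law t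
      = (∑ i, ∫ p, inner ℝ (X.ξ t (Y t p) p.2) (extGrad P ℓ F (Y t p) (S i)) ∂X.joint) / n := by
    have hi : ∀ i ∈ Finset.univ,
        Integrable (fun f => inner ℝ (X.mean t f) (extGrad P ℓ F f (S i))) (X.law t) :=
      fun i _ => (hmean.2 (S i)).1
    rw [integral_div, integral_finsetSum _ hi]
    simp_rw [hterm]
  have hV : ∫⁻ f, ∫⁻ z, ENNReal.ofReal (inner ℝ (X.mean t f) (extGrad P ℓ F f z) ^ 2)
        ∂((2 : ℝ≥0∞)⁻¹ • (P + empMeasure S)) ∂X.law t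
      = ∫⁻ f, ∫⁻ z, ENNReal.ofReal
          (inner ℝ (X.mean t f) (gradient (fun g => deviation P ℓ g z) f) ^ 2)
        ∂((2 : ℝ≥0∞)⁻¹ • (P + empMeasure S)) ∂X.law t := by
    refine lintegral_congr_ae ?_
    filter_upwards [hFt] with f hf
    refine lintegral_congr fun z => ?_
    rw [extGrad, if_pos hf]
  have hW : ∫⁻ f, localNorm (extSig F Sig f) (X.mean t f) ^ 2 ∂X.law t
      = ∫⁻ f, localNorm (Sig f) (X.mean t f) ^ 2 ∂X.law t := by
    refine lintegral_congr_ae ?_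
    filter_upwards [hFt] with f hf
    rw [extSig_of_mem hf]
  rw [hleft, hV, hW] at hmain
  exact hmain

/-- **Transportation bound.** On a good sample, a posterior flow from `Q` decreases the mean
sample-averaged deviation by at most the time integral of the increment bound. -/
lemma ofReal_integral_empDeviation_sub_le (hF : IsOpen F)
    (hℓ_meas : Measurable (Function.uncurry ℓ)) (hℓ_int : ∀ f ∈ F, Integrable (ℓ f) P)
    (hℓ_diff : ∀ z : Z, DifferentiableOn ℝ (fun f => ℓ f z) F)
    (hr_diff : DifferentiableOn ℝ (risk P ℓ) F)
    (hSig_meas : ∀ x : H, Measurable (fun f => Sig f x))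
    (hSig_pos : ∀ f ∈ F, (Sig f).IsPositive) (hL : 0 < L) (hLip : LipschitzDeviation P ℓ F Sig L)
    {e : ℕ → H} (he : DenseRange e) {n : ℕ} (hn : 0 < n) {δ : ℝ} (hδ : δ ∈ Ioo (0 : ℝ) 1)
    {U : Measure H} [IsProbabilityMeasure U] {S : Fin n → Z}
    (hS : S ∈ goodSamples P e (extSig F Sig) (extGrad P ℓ F) L n δ U)
    {Q : Measure H} [IsProbabilityMeasure Q] (X : PosteriorFlow.{u, w} F Sig Q)
    (hQ : Integrable (empDeviation P ℓ S) Q) (hQ₁ : Integrable (empDeviation P ℓ S) (X.law 1)) :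
    ENNReal.ofReal (∫ f, empDeviation P ℓ S f ∂Q - ∫ f, empDeviation P ℓ S f ∂X.law 1)
      ≤ ∫⁻ t in Icc (0 : ℝ) 1, incrementBound P ℓ L S U δ X t := by
  obtain ⟨Y, hY, hYc, hXY, hY0, hode, hfin⟩ := X.exists_version
  have hv : Measurable fun q : ℝ × (H × X.Ω) => X.ξ q.1 (Y q.1 q.2) q.2.2 :=
    X.measurable_ξ.comp (measurable_fst.prodMk (hY.prodMk (measurable_snd.comp measurable_snd)))
  have hYt : ∀ t, Measurable (Y t) := fun t => hY.comp (measurable_const.prodMk measurable_id)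
  have hD : Measurable (empDeviation P ℓ S) :=
    (Finset.measurable_sum _ fun i _ => measurable_deviation_left hℓ_meas (S i)).div_const _
  have hlaw : X.law 1 = X.joint.map (Y 1) :=
    Measure.map_congr (hXY.mono fun p hp => hp 1 zero_le_one)
  have hlaw0 : Q = X.joint.map (Y 0) := by
    rw [Measure.map_congr (hY0 : Y 0 =ᵐ[X.joint] Prod.fst)]
    exact (measurePreserving_fst (μ := Q) (ν := X.P₀)).map_eq.symm
  have h0 : ∫ f, empDeviation P ℓ S f ∂Q = ∫ p, empDeviation P ℓ S (Y 0 p) ∂X.joint := by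
    conv_lhs => rw [hlaw0]
    exact integral_map (hYt 0).aemeasurable hD.aestronglyMeasurable
  have h1 : ∫ f, empDeviation P ℓ S f ∂X.law 1 = ∫ p, empDeviation P ℓ S (Y 1 p) ∂X.joint := by
    rw [hlaw]
    exact integral_map (hYt 1).aemeasurable hD.aestronglyMeasurable
  have hi0 : Integrable (fun p => empDeviation P ℓ S (Y 0 p)) X.joint := by
    rw [hlaw0] at hQ
    exact hQ.comp_measurable (hYt 0)
  have hi1 : Integrable (fun p => empDeviation P ℓ S (Y 1 p)) X.joint := by
    rw [hlaw] at hQ₁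
    exact hQ₁.comp_measurable (hYt 1)
  have hz := fun z => integral_deviation_sub_eq (v := fun t p => X.ξ t (Y t p) p.2) hF hℓ_meas
    hℓ_diff hr_diff hSig_meas hSig_pos hL hLip hY hYc hv hode hfin z
  have hsub : ∫ f, empDeviation P ℓ S f ∂X.law 1 - ∫ f, empDeviation P ℓ S f ∂Q
      = ∫ t in Icc (0 : ℝ) 1, (∑ i, ∫ p, inner ℝ (X.ξ t (Y t p) p.2)
        (extGrad P ℓ F (Y t p) (S i)) ∂X.joint) / n := by
    rw [h0, h1, ← integral_sub hi1 hi0, integral_div,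
      integral_finsetSum _ fun i _ => (hz (S i)).1.integral_prod_left]
    simp_rw [← (hz _).2.2]
    rw [← integral_finsetSum _ fun i _ => (hz (S i)).2.1, ← integral_div]
    refine integral_congr_ae (ae_of_all _ fun p => ?_)
    simp only [empDeviation, Finset.sum_sub_distrib, sub_div]
  calc ENNReal.ofReal (∫ f, empDeviation P ℓ S f ∂Q - ∫ f, empDeviation P ℓ S f ∂X.law 1)
      ≤ ENNReal.ofReal ‖∫ t in Icc (0 : ℝ) 1, (∑ i, ∫ p, inner ℝ (X.ξ t (Y t p) p.2)
        (extGrad P ℓ F (Y t p) (S i)) ∂X.joint) / n‖ := by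
        refine ENNReal.ofReal_le_ofReal ?_
        rw [← hsub, norm_sub_rev]
        exact le_abs_self _
    _ ≤ ∫⁻ t in Icc (0 : ℝ) 1, ENNReal.ofReal |(∑ i, ∫ p, inner ℝ (X.ξ t (Y t p) p.2)
        (extGrad P ℓ F (Y t p) (S i)) ∂X.joint) / n| := by
        rw [ofReal_norm]
        refine (enorm_integral_le_lintegral_enorm _).trans_eq (lintegral_congr fun t => ?_)
        rw [Real.enorm_eq_ofReal_abs]
    _ ≤ ∫⁻ t in Icc (0 : ℝ) 1, incrementBound P ℓ L S U δ X t :=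
        lintegral_mono_ae (ae_abs_integral_le_incrementBound hF hℓ_meas hℓ_int hℓ_diff hr_diff
          hSig_meas hSig_pos hL hLip he hn hδ hS X hY hYc hXY hode hfin)

end Transport

end PACBayes

theorem corollary1
    {H : Type u} [NormedAddCommGroup H] [InnerProductSpace ℝ H] [CompleteSpace H]
    [SecondCountableTopology H] [MeasurableSpace H] [BorelSpace H]
    {Z : Type v} [MeasurableSpace Z]
    (P : Measure Z) [IsProbabilityMeasure P]
    (F : Set H) (hF : IsOpen F)
    (ℓ : H → Z → ℝ) (hℓ_meas : Measurable (Function.uncurry ℓ))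
    (hℓ_int : ∀ f ∈ F, Integrable (ℓ f) P)
    (hℓ_diff : ∀ z : Z, DifferentiableOn ℝ (fun f => ℓ f z) F)
    (hr_diff : DifferentiableOn ℝ (PACBayes.risk P ℓ) F)
    (Sig : H → H →L[ℝ] H) (hSig_meas : ∀ x : H, Measurable (fun f => Sig f x))
    (hSig_pos : ∀ f ∈ F, (Sig f).IsPositive)
    (L : ℝ≥0) (hL : 0 < L) (hLip : PACBayes.LipschitzDeviation P ℓ F Sig L)
    (n : ℕ) (hn : 0 < n) (δ : ℝ) (hδ : δ ∈ Ioo (0 : ℝ) 1)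
    (U : Measure H) [IsProbabilityMeasure U] (hU : U Fᶜ = 0) :
    ∃ E : Set (Fin n → Z), MeasurableSet E ∧
      ENNReal.ofReal (1 - δ) ≤ Measure.pi (fun _ : Fin n => P) E ∧
      ∀ S ∈ E, ∀ (Q₀ Q : Measure H) [IsProbabilityMeasure Q₀] [IsProbabilityMeasure Q],
        Q₀ Fᶜ = 0 → Q Fᶜ = 0 →
        Integrable (PACBayes.risk P ℓ) Q → Integrable (PACBayes.empRisk ℓ S) Q →
        Integrable (PACBayes.empDeviation P ℓ S) Q₀ →
        ((∫ f, PACBayes.risk P ℓ f ∂Q : ℝ) : EReal) ≤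
          ((∫ f, PACBayes.empRisk ℓ S f ∂Q : ℝ) : EReal)
            + ((PACBayes.otDistance.{u, v, w} P ℓ F Sig L S U δ Q Q₀ : ℝ≥0∞) : EReal)
            + ((∫ f, PACBayes.empDeviation P ℓ S f ∂Q₀ : ℝ) : EReal) := by
  have hT := PACBayes.measurable_extSig hF hSig_meas
  have hG := PACBayes.measurable_inner_extGrad (P := P) hF hℓ_meas hℓ_diff hr_diff
  refine ⟨PACBayes.goodSamples P (TopologicalSpace.denseSeq H) (PACBayes.extSig F Sig)
    (PACBayes.extGrad P ℓ F) L n δ U, PACBayes.measurableSet_goodSamples hT hG n δ U,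
    PACBayes.le_measure_goodSamples hT hG (PACBayes.extSig_isPositive hSig_pos)
      (PACBayes.inner_extSig_extGrad_le hF hℓ_diff hr_diff hSig_pos hLip) n hδ U, ?_⟩
  intro S hS Q₀ Q _ _ _ _ hr hrS hD₀
  have hDeq : PACBayes.empDeviation P ℓ S
      = fun f => PACBayes.risk P ℓ f - PACBayes.empRisk ℓ S f :=
    funext fun f => PACBayes.empDeviation_eq hn S f
  have hD : Integrable (PACBayes.empDeviation P ℓ S) Q := by
    rw [hDeq]; exact hr.sub hrS
  have hDint : ∫ f, PACBayes.empDeviation P ℓ S f ∂Q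
      = ∫ f, PACBayes.risk P ℓ f ∂Q - ∫ f, PACBayes.empRisk ℓ S f ∂Q := by
    rw [hDeq]; exact integral_sub hr hrS
  have hd : ENNReal.ofReal (∫ f, PACBayes.empDeviation P ℓ S f ∂Q
      - ∫ f, PACBayes.empDeviation P ℓ S f ∂Q₀)
      ≤ PACBayes.otDistance.{u, v, w} P ℓ F Sig L S U δ Q Q₀ := by
    refine le_iInf₂ fun X hX => ?_
    subst hX
    exact PACBayes.ofReal_integral_empDeviation_sub_le hF hℓ_meas hℓ_int hℓ_diff hr_diff hSig_meas
      hSig_pos hL hLip (TopologicalSpace.denseRange_denseSeq H) hn hδ hS X hD hD₀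
  by_cases hdt : PACBayes.otDistance.{u, v, w} P ℓ F Sig L S U δ Q Q₀ = ⊤
  · rw [hdt, EReal.coe_ennreal_top, EReal.coe_add_top, EReal.top_add_coe]
    exact le_top
  · rw [← ENNReal.ofReal_toReal hdt] at hd ⊢
    rw [EReal.coe_ennreal_ofReal, max_eq_left ENNReal.toReal_nonneg, ← EReal.coe_add,
      ← EReal.coe_add, EReal.coe_le_coe_iff]
    have h := (ENNReal.ofReal_le_ofReal_iff ENNReal.toReal_nonneg).mp hd
    linarith
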